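/- Let $L$ be a finite-dimensional solvable (left) Leibniz algebra over an arbitrary field $F$, i.e. $a(bc)=(ab)c+b(ac)$ for all $a,b,c\in L$. Call an algebra $K$ supersolvable if it has a chain of ideals $0=K_0\subset K_1\subset\dots\subset K_n=K$ with $\dim K_i=i$; strongly solvable if $K^2$ is nilpotent; and call $L$ $\phi$-free if the largest ideal of $L$ contained in the intersection of all maximal subalgebras of $L$ is $0$. Let $\mathrm{Leib}(L)$ be the span of all squares $aa$, $a\in L$; $L$ is a Lie algebra iff $\mathrm{Leib}(L)=0$. **Theorem.** Suppose that $L$ is $\phi$-free and not supersolvable, and that every proper subalgebra of $L$ generated by two (not necessarily distinct) elements is supersolvable. Then $L$ is minimally non-supersolvable, i.e. $L$ is not supersolvable but all its proper subalgebras are. Moreover $L$ has a unique minimal ideal $A$, $A^2=0$, and the following hold. 1. If $L$ is strongly solvable, then $\dim A>1$ and $L=A\dotplus\langle x\rangle$ (a direct sum of vector spaces) for some $x\neq 0$ with $xx=0$. 2. If $L$ is not strongly solvable, then $F$ has characteristic $p>0$, and $A$ has a basis $(e_i)_{i\in\mathbb Z/p}$ such that one of the following holds. * (a) $L=A\dotplus\langle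 x,y\rangle$ with $x,y$ linearly independent, $xe_i=e_{i+1}$ and $ye_i=(\alpha+i)e_i$ for some $\alpha\in F$ (indices mod $p$), $yx=-xy=x$, $xx=yy=0$, and every $a\in F$ is of the form $a=t^p-t$ with $t\in F$. * (b) $L=A\dotplus\langle x,y,z\rangle$ with $x,y,z$ linearly independent, $xe_i=e_{i+1}$, $ye_i=(i+1)e_{i-1}$, $ze_i=e_i$ (indices mod $p$), $yx=-xy=z$, all other products of two of $x,y,z$ (including squares) are $0$, and $F$ is perfect when $p=2$. 3. If $L$ is not a Lie algebra, then $A=\mathrm{Leib}(L)$ and $AL=0$. (If $L$ is a Lie algebra, the products not listed above are determined by antisymmetry.) -/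

import Mathlib

namespace LeibnizAlg

section Basic

variable (F : Type*) [Field F] (L : Type*) [NonUnitalNonAssocRing L] [Module F L]

/-- The (left) Leibniz identity `a(bc) = (ab)c + b(ac)`.  A Leibniz algebra over `F` is a
(non-associative, non-unital) `F`-algebra whose product satisfies it. -/
class IsLeibniz (L : Type*) [NonUnitalNonAssocRing L] : Prop where
  leibniz : ∀ a b c : L, a * (b * c) = (a * b) * c + b * (a * c)

/-- A Leibniz algebra is a Lie algebra iff its product is alternating
(for the Leibniz identity is then the Jacobi identity). -/
def IsLie (L : Type*) [NonUnitalNonAssocRing L] : Prop := ∀ a : L, a * a = 0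

variable {L} in
/-- The product `UV` of two subspaces: the span of all products `uv`. -/
def mulSpan (U V : Submodule F L) : Submodule F L :=
  Submodule.span F {w | ∃ u ∈ U, ∃ v ∈ V, w = u * v}

variable {F L} in
/-- Two-sided ideals (as subspaces). -/
def IsIdeal (I : Submodule F L) : Prop :=
  ∀ a ∈ I, ∀ l : L, a * l ∈ I ∧ l * a ∈ I

/-- `Leib(L)`: the span of all squares. -/
def leib : Submodule F L := Submodule.span F {w | ∃ a : L, w = a * a}

/-- The derived series `L ⊇ L² ⊇ (L²)² ⊇ ⋯`. -/
def derivedSeries : ℕ → Submodule F L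
  | 0 => ⊤
  | n + 1 => mulSpan F (derivedSeries n) (derivedSeries n)

/-- Solvability. -/
def IsSolvable : Prop := ∃ n, derivedSeries F L n = ⊥

variable {L} in
/-- The lower central series `U ⊇ UU ⊇ U(UU) ⊇ ⋯` of a subalgebra `U`. -/
def lowerCentralSeries (U : Submodule F L) : ℕ → Submodule F L
  | 0 => U
  | n + 1 => mulSpan F U (lowerCentralSeries U n)

/-- `L` is strongly solvable: `L²` is nilpotent. -/
def IsStronglySolvable : Prop :=
  ∃ n, lowerCentralSeries F (mulSpan F (⊤ : Submodule F L) ⊤) n = ⊥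

/-- `L` is supersolvable: there is a chain `0 = L₀ ⊆ L₁ ⊆ ⋯ ⊆ Lₙ = L` of ideals of `L`
with `dim Lᵢ = i`. -/
def IsSupersolvable : Prop :=
  ∃ (n : ℕ) (I : Fin (n + 1) → Submodule F L), Monotone I ∧ I (Fin.last n) = ⊤ ∧
    ∀ i, IsIdeal (I i) ∧ Module.Finite F (I i) ∧ Module.finrank F (I i) = i

variable {F L} in
/-- Minimal ideals: minimal among the nonzero ideals. -/
def IsMinimalIdeal (A : Submodule F L) : Prop :=
  IsIdeal A ∧ A ≠ ⊥ ∧ ∀ I : Submodule F L, IsIdeal I → I ≤ A → I = ⊥ ∨ I = A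

variable {F L} in
/-- `A` is the unique minimal ideal. -/
def IsUniqueMinimalIdeal (A : Submodule F L) : Prop :=
  IsMinimalIdeal A ∧ ∀ B : Submodule F L, IsMinimalIdeal B → B = A

end Basic

section Subalgebras

variable (F : Type*) [Field F] (L : Type*) [NonUnitalNonAssocRing L] [Module F L]
  [IsScalarTower F L L] [SMulCommClass F L L]

/-- The Frattini subalgebra: the intersection of all maximal (proper) subalgebras. -/
def frattiniSubalgebra : NonUnitalSubalgebra F L :=
  sInf {M : NonUnitalSubalgebra F L | IsCoatom M}

/-- The Frattini ideal: the largest ideal contained in the Frattini subalgebra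
(the sum of all such ideals). -/
def frattiniIdeal : Submodule F L :=
  sSup {I : Submodule F L | IsIdeal I ∧ I ≤ (frattiniSubalgebra F L).toSubmodule}

/-- `L` is `φ`-free: its Frattini ideal is zero. -/
def IsPhiFree : Prop := frattiniIdeal F L = ⊥

variable {F L} in
/-- `S` is two-generated: it is generated by two (not necessarily distinct) elements. -/
def IsTwoGenerated (S : NonUnitalSubalgebra F L) : Prop :=
  ∃ a b : L, S = NonUnitalAlgebra.adjoin F {a, b}

/-- `L` is minimally non-supersolvable. -/
def IsMinimallyNonSupersolvable : Prop :=
  ¬ IsSupersolvable F L ∧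
    ∀ S : NonUnitalSubalgebra F L, S ≠ ⊤ → IsSupersolvable F S

end Subalgebras

section Structures

variable {F : Type*} [Field F] {L : Type*} [NonUnitalNonAssocRing L] [Module F L]

/-- `L = A ∔ ⟨x⟩` (vector space direct sum), `x ≠ 0`, `x² = 0`, `A² = 0` and `dim A > 1`. -/
def IsCyclicExtension (A : Submodule F L) : Prop :=
  1 < Module.finrank F A ∧ (∀ a ∈ A, ∀ b ∈ A, a * b = 0) ∧
    ∃ x : L, x ≠ 0 ∧ x * x = 0 ∧ IsCompl A (Submodule.span F {x})

/-- `L = A ∔ ⟨x, y⟩` with `x, y` independent, `A` of dimension `p` with basis `(eᵢ)`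
indexed mod `p`, `A² = 0`, `x eᵢ = eᵢ₊₁`, `y eᵢ = (α + i) eᵢ`, `yx = x = -xy`, `x² = y² = 0`,
and every element of `F` is of the form `t ^ p - t`. -/
def IsNonabelianType (p : ℕ) (A : Submodule F L) : Prop :=
  (∀ a ∈ A, ∀ b ∈ A, a * b = 0) ∧
  (∃ (e : Module.Basis (ZMod p) F A) (x y : L) (α : F),
    LinearIndependent F ![x, y] ∧ IsCompl A (Submodule.span F {x, y}) ∧
    (∀ i, x * (e i : L) = (e (i + 1) : L)) ∧
    (∀ i, y * (e i : L) = (α + (i.cast : F)) • (e i : L)) ∧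
    y * x = x ∧ x * y = -x ∧ x * x = 0 ∧ y * y = 0) ∧
  ∀ a : F, ∃ t : F, a = t ^ p - t

/-- `L = A ∔ ⟨x, y, z⟩` with `x, y, z` independent, `A` of dimension `p` with basis `(eᵢ)`
indexed mod `p`, `A² = 0`, `x eᵢ = eᵢ₊₁`, `y eᵢ = (i + 1) eᵢ₋₁`, `z eᵢ = eᵢ`,
`⟨x, y, z⟩` the Heisenberg Lie algebra with `yx = z = -xy`, and `F` is perfect if `p = 2`. -/
def IsHeisenbergType (p : ℕ) (A : Submodule F L) : Prop :=
  (∀ a ∈ A, ∀ b ∈ A, a * b = 0) ∧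
  (∃ (e : Module.Basis (ZMod p) F A) (x y z : L),
    LinearIndependent F ![x, y, z] ∧ IsCompl A (Submodule.span F {x, y, z}) ∧
    (∀ i, x * (e i : L) = (e (i + 1) : L)) ∧
    (∀ i, y * (e i : L) = ((i.cast : F) + 1) • (e (i - 1) : L)) ∧
    (∀ i, z * (e i : L) = (e i : L)) ∧
    y * x = z ∧ x * y = -z ∧ x * z = 0 ∧ z * x = 0 ∧ y * z = 0 ∧ z * y = 0 ∧
    x * x = 0 ∧ y * y = 0 ∧ z * z = 0) ∧
  (p = 2 → PerfectField F)

variable (F L) in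
/-- The list of structures of `φ`-free solvable minimally non-supersolvable Leibniz algebras.
In the Lie case the products of elements of `A` with elements of the complement on the right are
determined by antisymmetry; in the non-Lie case they vanish. -/
def HasListedStructure : Prop :=
  ∃ A : Submodule F L, IsUniqueMinimalIdeal A ∧
    (IsStronglySolvable F L → IsCyclicExtension A) ∧
    (¬ IsStronglySolvable F L →
      ∃ p : ℕ, p.Prime ∧ CharP F p ∧ (IsNonabelianType p A ∨ IsHeisenbergType p A)) ∧
    (¬ IsLie L → A = leib F L ∧ ∀ a ∈ A, ∀ l : L, a * l = 0)

end Structures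

end LeibnizAlg

set_option linter.unusedSectionVars false

namespace LeibnizAlg

/-! ### Ideals, and chains of ideals with steps of dimension at most one. -/

section Ideals

variable {F : Type*} [Field F] {L : Type*} [NonUnitalNonAssocRing L] [Module F L]

/-! The proof first shows that two-generated subalgebras control supersolvability. In a
supersolvable algebra `a` and `b` act on each chain factor by scalars, so left multiplication by
`ab` is nilpotent. Suppose `ab` acts injectively on a nonzero abelian ideal `A`. By dimension, `(v,
w) ↦ av + wb` from `A × A` to `A` has a nonzero kernel element, and then `(a + w)(b + v) = ab`. If
both pairs generated supersolvable subalgebras, a power of `ab` would kill `a`, `a + w`, `b` and `b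
+ v`, hence `v` and `w`, which is absurd (`exists_not_isSupersolvable_adjoin`).

Such products come from `IsMinimalIdeal.exists_mul_action`: over an abelian minimal ideal `A` with
`dim A > 1`, supersolvable quotient, and an eigenvector for every element, two elements act by
operators with `[Y, X] = 1`, or `[Y, X] = X` and `X` injective. Induction on dimension gives
`isSupersolvable_of_forall_adjoin`; applied to proper subalgebras, it gives minimality.

For the structure, `φ`-freeness splits off a minimal ideal: `L = A ∔ M` with `M` a supersolvable
subalgebra. Then `dim A > 1`, `A` is the only minimal ideal and `M` acts faithfully on it, so
products in `M` are read off from commutators on `A`. Unless some `A + ⟨m⟩` is all of `L`, these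
subalgebras are supersolvable, every element has an eigenvector, and `X`, `Y` appear again. A trace
argument forces characteristic `p`; minimality forces `L` to be spanned by `A`, `x`, `y`, `yx`; `X ^
p` is central, hence scalar, and is normalised to `1`; powers of `X` applied to an eigenvector of
`Y` form the basis. The conditions on `F` say that the elements `y + sx`, respectively `x + (b -
1)y`, have eigenvectors too. -/

theorem isIdeal_top : IsIdeal (⊤ : Submodule F L) := fun _ _ _ => ⟨trivial, trivial⟩

theorem isIdeal_bot : IsIdeal (⊥ : Submodule F L) := by
  intro a ha l
  rw [Submodule.mem_bot] at ha
  simp [ha]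

theorem IsIdeal.inf {I J : Submodule F L} (hI : IsIdeal I) (hJ : IsIdeal J) : IsIdeal (I ⊓ J) :=
  fun a ha l => ⟨⟨(hI a ha.1 l).1, (hJ a ha.2 l).1⟩, ⟨(hI a ha.1 l).2, (hJ a ha.2 l).2⟩⟩

theorem IsMinimalIdeal.eq_of_inf_ne_bot {A B : Submodule F L} (hA : IsMinimalIdeal A)
    (hB : IsIdeal B) (h : A ⊓ B ≠ ⊥) : A ≤ B := by
  rcases hA.2.2 _ (hA.1.inf hB) inf_le_left with h' | h'
  · exact absurd h' h
  · exact inf_eq_left.mp h'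

theorem exists_isMinimalIdeal_le [Module.Finite F L] {I : Submodule F L} (hI : IsIdeal I)
    (hI0 : I ≠ ⊥) : ∃ A : Submodule F L, IsMinimalIdeal A ∧ A ≤ I := by
  obtain ⟨A, ⟨hA, hA0, hAI⟩, hmin⟩ := WellFounded.has_min
    (wellFounded_lt (α := Submodule F L)) {J | IsIdeal J ∧ J ≠ ⊥ ∧ J ≤ I} ⟨I, hI, hI0, le_rfl⟩
  refine ⟨A, ⟨hA, hA0, fun J hJ hJA => ?_⟩, hAI⟩
  by_contra! h
  exact hmin J ⟨hJ, h.1, hJA.trans hAI⟩ (lt_of_le_of_ne hJA h.2)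

variable (F L) in
/-- `SupersolvableOver F L B` says that `L / B` is supersolvable: there is a chain of ideals from
`B` to `L` in which each ideal is obtained from the preceding one by adding one vector. -/
inductive SupersolvableOver : Submodule F L → Prop
  | top : SupersolvableOver ⊤
  | step (B : Submodule F L) (x : L) : IsIdeal B →
      SupersolvableOver (B ⊔ Submodule.span F {x}) → SupersolvableOver B

theorem SupersolvableOver.isIdeal {B : Submodule F L} (h : SupersolvableOver F L B) :
    IsIdeal B := by
  cases h with
  | top => exact isIdeal_top
  | step _ _ hB _ => exact hB

theorem _root_.Submodule.finrank_span_singleton_le {V : Type*} [AddCommGroup V] [Module F V]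
    (x : V) : Module.finrank F (Submodule.span F {x}) ≤ 1 := by
  simpa using finrank_span_le_card (R := F) ({x} : Set V)

theorem finrank_sup_span_singleton [Module.Finite F L] {B : Submodule F L} {x : L} (hx : x ∉ B) :
    Module.finrank F ↥(B ⊔ Submodule.span F {x}) = Module.finrank F B + 1 := by
  have h0 : x ≠ 0 := fun h => hx (h ▸ B.zero_mem)
  have h := Submodule.finrank_sup_add_finrank_inf_eq B (Submodule.span F {x})
  have hd : Disjoint B (Submodule.span F {x}) := (Submodule.disjoint_span_singleton' h0).mpr hx
  rw [hd.eq_bot, finrank_bot, finrank_span_singleton h0] at h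
  simpa using h

/-- The argument `I` accumulates the chain already built from `0` to `B`, constant from index `dim
B` on. The recursion runs upwards from `B`, so each step lengthens `I` before calling the induction
hypothesis; steps that add nothing are skipped. -/
theorem SupersolvableOver.exists_chain [Module.Finite F L] {B : Submodule F L}
    (h : SupersolvableOver F L B) : ∀ I : ℕ → Submodule F L, Monotone I →
      (∀ i, Module.finrank F B ≤ i → I i = B) →
      (∀ i, IsIdeal (I i)) → (∀ i ≤ Module.finrank F B, Module.finrank F (I i) = i) →
      ∃ (n : ℕ) (J : ℕ → Submodule F L), Monotone J ∧ J n = ⊤ ∧ (∀ i, IsIdeal (J i)) ∧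
        ∀ i ≤ n, Module.finrank F (J i) = i := by
  induction h with
  | top =>
    intro I hm hI hid hd
    exact ⟨_, I, hm, hI _ le_rfl, hid, hd⟩
  | step B x hB hC ih =>
    intro I hm hI hid hd
    by_cases hx : x ∈ B
    · have : B ⊔ Submodule.span F {x} = B := by
        rw [sup_eq_left, Submodule.span_singleton_le_iff_mem]; exact hx
      rw [this] at ih
      exact ih I hm hI hid hd
    · have hf := finrank_sup_span_singleton hx
      refine ih (fun i => if i ≤ Module.finrank F B then I i else B ⊔ Submodule.span F {x})
        ?_ ?_ ?_ ?_
      · intro i j hij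
        dsimp only
        split_ifs with h1 h2 h2
        · exact hm hij
        · exact ((hm h1).trans (hI _ le_rfl).le).trans le_sup_left
        · omega
        · exact le_rfl
      · intro i hi
        rw [if_neg (by omega)]
      · intro i
        split_ifs
        · exact hid i
        · exact hC.isIdeal
      · intro i hi
        by_cases h1 : i ≤ Module.finrank F B
        · rw [if_pos h1]; exact hd i h1
        · rw [if_neg h1]; omega

theorem isSupersolvable_of_supersolvableOver_bot [Module.Finite F L]
    (h : SupersolvableOver F L ⊥) : IsSupersolvable F L := by
  obtain ⟨n, J, hm, ht, hid, hd⟩ := h.exists_chain (fun _ => ⊥) monotone_const (fun _ _ => rfl)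
    (fun _ => isIdeal_bot) (fun i hi => by simp at hi ⊢; exact hi.symm)
  refine ⟨n, fun i => J i, fun i j hij => hm hij, by simpa using ht, fun i => ⟨hid _, ?_, hd _ ?_⟩⟩
  · infer_instance
  · exact Nat.lt_succ_iff.mp i.2

theorem exists_sup_span_singleton_of_finrank [Module.Finite F L] {B C : Submodule F L} (h : B ≤ C)
    (hf : Module.finrank F C = Module.finrank F B + 1) : ∃ x, B ⊔ Submodule.span F {x} = C := by
  have hne : ¬ C ≤ B := fun h' => by
    rw [le_antisymm h h'] at hf; omega
  obtain ⟨x, hxC, hxB⟩ := Set.not_subset.mp hne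
  refine ⟨x, Submodule.eq_of_le_of_finrank_eq ?_ ?_⟩
  · exact sup_le h ((Submodule.span_singleton_le_iff_mem _ _).mpr hxC)
  · rw [finrank_sup_span_singleton hxB, hf]

theorem IsSupersolvable.supersolvableOver_bot [Module.Finite F L] (h : IsSupersolvable F L) :
    SupersolvableOver F L ⊥ := by
  obtain ⟨n, I, hm, ht, hI⟩ := h
  have key : ∀ i, SupersolvableOver F L (I i) := by
    intro i
    induction i using Fin.reverseInduction with
    | last => rw [ht]; exact .top
    | cast i ih =>
      obtain ⟨x, hx⟩ := exists_sup_span_singleton_of_finrank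
        (hm (Fin.castSucc_le_succ i)) (by rw [(hI _).2.2, (hI _).2.2]; simp)
      exact .step _ x (hI _).1 (hx ▸ ih)
  have h0 : I 0 = ⊥ := Submodule.finrank_eq_zero.mp (by simpa using (hI 0).2.2)
  exact h0 ▸ key 0

theorem exists_smul_add_of_mem_sup_span {B : Submodule F L} {x u : L}
    (hu : u ∈ B ⊔ Submodule.span F {x}) : ∃ t : F, u - t • x ∈ B := by
  obtain ⟨b, hb, y, hy, rfl⟩ := Submodule.mem_sup.mp hu
  obtain ⟨t, rfl⟩ := Submodule.mem_span_singleton.mp hy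
  exact ⟨t, by simpa using hb⟩

theorem mem_sup_span_of_sub_mem {B : Submodule F L} {x u : L} {t : F}
    (hu : u - t • x ∈ B) : u ∈ B ⊔ Submodule.span F {x} :=
  Submodule.mem_sup.mpr ⟨_, hu, _, Submodule.mem_span_singleton.mpr ⟨t, rfl⟩, by abel⟩

end Ideals

/-! ### Transfer of supersolvability and solvability along homomorphisms. -/

section Homs

variable {F : Type*} [Field F] {L : Type*} [NonUnitalNonAssocRing L] [Module F L]
  {L' : Type*} [NonUnitalNonAssocRing L'] [Module F L']

theorem IsIdeal.comap {B : Submodule F L'} (hB : IsIdeal B) (f : L →ₗ[F] L')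
    (hf : ∀ a b, f (a * b) = f a * f b) : IsIdeal (B.comap f) := by
  intro a ha l
  simp only [Submodule.mem_comap, hf] at ha ⊢
  exact hB _ ha _

theorem IsIdeal.map {B : Submodule F L} (hB : IsIdeal B) (f : L →ₗ[F] L')
    (hf : ∀ a b, f (a * b) = f a * f b) (hs : Function.Surjective f) : IsIdeal (B.map f) := by
  rintro _ ⟨a, ha, rfl⟩ l
  obtain ⟨l, rfl⟩ := hs l
  rw [← hf, ← hf]
  exact ⟨⟨_, (hB a ha l).1, rfl⟩, ⟨_, (hB a ha l).2, rfl⟩⟩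

theorem SupersolvableOver.comap {B : Submodule F L'} (hB : SupersolvableOver F L' B)
    (f : L →ₗ[F] L') (hf : ∀ a b, f (a * b) = f a * f b) :
    SupersolvableOver F L (B.comap f) := by
  induction hB with
  | top => rw [Submodule.comap_top]; exact .top
  | step B x hB _ ih =>
    -- A step of the chain may collapse when pulled back, since `f` need not be surjective;
    -- otherwise any new vector `y` generates the step, because `f y` has a nonzero component `t`
    -- along `x`.
    by_cases h : (B ⊔ Submodule.span F {x}).comap f ≤ B.comap f
    · rw [le_antisymm (Submodule.comap_mono le_sup_left) h]; exact ih
    obtain ⟨y, hy, hyB⟩ := Set.not_subset.mp h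
    refine .step _ y (hB.comap f hf) ?_
    convert ih
    obtain ⟨t, ht⟩ := exists_smul_add_of_mem_sup_span hy
    have ht0 : t ≠ 0 := by
      rintro rfl
      exact hyB (by simpa using ht)
    apply le_antisymm
    · refine sup_le (Submodule.comap_mono le_sup_left) ?_
      rw [Submodule.span_singleton_le_iff_mem]; exact hy
    · intro u hu
      obtain ⟨s, hs⟩ := exists_smul_add_of_mem_sup_span hu
      refine mem_sup_span_of_sub_mem (t := s * t⁻¹) ?_
      rw [Submodule.mem_comap, map_sub, map_smul]
      have : f u - (s * t⁻¹) • f y = (f u - s • x) - (s * t⁻¹) • (f y - t • x) := by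
        rw [smul_sub, smul_smul, mul_assoc, inv_mul_cancel₀ ht0, mul_one]; abel
      rw [this]
      exact B.sub_mem hs (B.smul_mem _ ht)

theorem SupersolvableOver.map {B : Submodule F L} (hB : SupersolvableOver F L B)
    (f : L →ₗ[F] L') (hf : ∀ a b, f (a * b) = f a * f b) (hs : Function.Surjective f) :
    SupersolvableOver F L' (B.map f) := by
  induction hB with
  | top => rw [Submodule.map_top, LinearMap.range_eq_top.mpr hs]; exact .top
  | step B x hB _ ih =>
    refine .step _ (f x) (hB.map f hf hs) ?_
    rwa [Submodule.map_sup, Submodule.map_span, Set.image_singleton] at ih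

theorem IsSupersolvable.of_injective [Module.Finite F L] [Module.Finite F L']
    (h : IsSupersolvable F L') (f : L →ₗ[F] L') (hf : ∀ a b, f (a * b) = f a * f b)
    (hi : Function.Injective f) : IsSupersolvable F L := by
  have := h.supersolvableOver_bot.comap f hf
  rw [Submodule.comap_bot, LinearMap.ker_eq_bot.mpr hi] at this
  exact isSupersolvable_of_supersolvableOver_bot this

theorem IsSupersolvable.of_surjective [Module.Finite F L] [Module.Finite F L']
    (h : IsSupersolvable F L) (f : L →ₗ[F] L') (hf : ∀ a b, f (a * b) = f a * f b)
    (hs : Function.Surjective f) : IsSupersolvable F L' := by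
  have := h.supersolvableOver_bot.map f hf hs
  rw [Submodule.map_bot] at this
  exact isSupersolvable_of_supersolvableOver_bot this

theorem map_mulSpan (f : L →ₗ[F] L') (hf : ∀ a b, f (a * b) = f a * f b) (U V : Submodule F L) :
    (mulSpan F U V).map f = mulSpan F (U.map f) (V.map f) := by
  rw [mulSpan, mulSpan, Submodule.map_span]
  congr 1
  ext w
  constructor
  · rintro ⟨_, ⟨u, hu, v, hv, rfl⟩, rfl⟩
    exact ⟨f u, ⟨u, hu, rfl⟩, f v, ⟨v, hv, rfl⟩, hf u v⟩
  · rintro ⟨_, ⟨u, hu, rfl⟩, _, ⟨v, hv, rfl⟩, rfl⟩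
    exact ⟨u * v, ⟨u, hu, v, hv, rfl⟩, hf u v⟩

theorem mulSpan_mono {U V U' V' : Submodule F L} (h : U ≤ U') (h' : V ≤ V') :
    mulSpan F U V ≤ mulSpan F U' V' := by
  apply Submodule.span_mono
  rintro _ ⟨u, hu, v, hv, rfl⟩
  exact ⟨u, h hu, v, h' hv, rfl⟩

theorem mul_mem_mulSpan {U V : Submodule F L} {u v : L} (hu : u ∈ U) (hv : v ∈ V) :
    u * v ∈ mulSpan F U V := Submodule.subset_span ⟨u, hu, v, hv, rfl⟩

theorem mulSpan_le {U V W : Submodule F L} (h : ∀ u ∈ U, ∀ v ∈ V, u * v ∈ W) :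
    mulSpan F U V ≤ W := by
  apply Submodule.span_le.mpr
  rintro _ ⟨u, hu, v, hv, rfl⟩
  exact h u hu v hv

theorem map_derivedSeries_le (f : L →ₗ[F] L') (hf : ∀ a b, f (a * b) = f a * f b) (n : ℕ) :
    (derivedSeries F L n).map f ≤ derivedSeries F L' n := by
  induction n with
  | zero => exact le_top
  | succ n ih =>
    rw [derivedSeries, derivedSeries, map_mulSpan f hf]
    exact mulSpan_mono ih ih

theorem map_derivedSeries (f : L →ₗ[F] L') (hf : ∀ a b, f (a * b) = f a * f b)
    (hs : Function.Surjective f) (n : ℕ) :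
    (derivedSeries F L n).map f = derivedSeries F L' n := by
  induction n with
  | zero => rw [derivedSeries, derivedSeries, Submodule.map_top, LinearMap.range_eq_top.mpr hs]
  | succ n ih => rw [derivedSeries, derivedSeries, map_mulSpan f hf, ih]

theorem IsSolvable.of_injective (h : IsSolvable F L') (f : L →ₗ[F] L')
    (hf : ∀ a b, f (a * b) = f a * f b) (hi : Function.Injective f) : IsSolvable F L := by
  obtain ⟨n, hn⟩ := h
  refine ⟨n, ?_⟩
  have := map_derivedSeries_le f hf n
  rw [hn, le_bot_iff] at this
  exact Submodule.map_injective_of_injective hi (this.trans (Submodule.map_bot f).symm)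

theorem IsSolvable.of_surjective (h : IsSolvable F L) (f : L →ₗ[F] L')
    (hf : ∀ a b, f (a * b) = f a * f b) (hs : Function.Surjective f) : IsSolvable F L' := by
  obtain ⟨n, hn⟩ := h
  exact ⟨n, by rw [← map_derivedSeries f hf hs, hn, Submodule.map_bot]⟩

end Homs

/-! ### Quotients by ideals. -/

section Quotient

universe u

variable {F : Type*} [Field F] {L : Type u} [NonUnitalNonAssocRing L] [Module F L]

/-- The product on the quotient of an algebra by an ideal. -/
abbrev quotientRing (A : Submodule F L) (hA : IsIdeal A) : NonUnitalNonAssocRing (L ⧸ A) where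
  __ := Submodule.Quotient.addCommGroup A
  mul := Quotient.map₂ (· * ·) (by
    intro a b hab c d hcd
    rw [← Quotient.eq_iff_equiv] at *
    have hab' : a - b ∈ A := (Submodule.Quotient.eq A).mp hab
    have hcd' : c - d ∈ A := (Submodule.Quotient.eq A).mp hcd
    refine (Submodule.Quotient.eq A).mpr ?_
    have : a * c - b * d = a * (c - d) + (a - b) * d := by
      rw [mul_sub, sub_mul]; abel
    rw [this]
    exact A.add_mem (hA _ hcd' _).2 (hA _ hab' _).1)
  left_distrib := by
    rintro ⟨a⟩ ⟨b⟩ ⟨c⟩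
    exact congrArg (Submodule.Quotient.mk (p := A)) (mul_add a b c)
  right_distrib := by
    rintro ⟨a⟩ ⟨b⟩ ⟨c⟩
    exact congrArg (Submodule.Quotient.mk (p := A)) (add_mul a b c)
  zero_mul := by
    rintro ⟨a⟩
    exact congrArg (Submodule.Quotient.mk (p := A)) (zero_mul a)
  mul_zero := by
    rintro ⟨a⟩
    exact congrArg (Submodule.Quotient.mk (p := A)) (mul_zero a)

/-- `Q` stays in the universe of `L` so that an induction over all algebras of that universe can be
applied to it. -/
theorem exists_quotient [IsScalarTower F L L] [SMulCommClass F L L] (A : Submodule F L)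
    (hA : IsIdeal A) : ∃ (Q : Type u) (_ : NonUnitalNonAssocRing Q) (_ : Module F Q)
      (_ : IsScalarTower F Q Q) (_ : SMulCommClass F Q Q) (f : L →ₗ[F] Q),
      Function.Surjective f ∧ LinearMap.ker f = A ∧ ∀ a b, f (a * b) = f a * f b := by
  let _ := quotientRing A hA
  refine ⟨L ⧸ A, quotientRing A hA, Submodule.Quotient.module A, ⟨?_⟩, ⟨?_⟩, A.mkQ,
    A.mkQ_surjective, A.ker_mkQ, fun _ _ => rfl⟩
  · rintro t ⟨a⟩ ⟨b⟩
    exact congrArg (Submodule.Quotient.mk (p := A)) (smul_mul_assoc t a b)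
  · rintro t ⟨a⟩ ⟨b⟩
    exact congrArg (Submodule.Quotient.mk (p := A)) (mul_smul_comm t a b).symm

end Quotient

/-! ### Leibniz identities and the action on minimal ideals. -/

section Leibniz

variable {F : Type*} [Field F] {L : Type*} [NonUnitalNonAssocRing L] [Module F L]

theorem IsLeibniz.mul_mul_eq [IsLeibniz L] (a b c : L) :
    (a * b) * c = a * (b * c) - b * (a * c) := by
  rw [IsLeibniz.leibniz a b c]; abel

theorem IsLeibniz.of_injective {L' : Type*} [NonUnitalNonAssocRing L'] [Module F L'] [IsLeibniz L']
    (f : L →ₗ[F] L') (hf : ∀ a b, f (a * b) = f a * f b) (hi : Function.Injective f) :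
    IsLeibniz L :=
  ⟨fun a b c => hi (by simp only [map_add, hf]; exact IsLeibniz.leibniz _ _ _)⟩

theorem IsLeibniz.of_surjective [IsLeibniz L] {L' : Type*} [NonUnitalNonAssocRing L'] [Module F L']
    (f : L →ₗ[F] L') (hf : ∀ a b, f (a * b) = f a * f b) (hs : Function.Surjective f) :
    IsLeibniz L' := by
  refine ⟨fun a b c => ?_⟩
  obtain ⟨a, rfl⟩ := hs a
  obtain ⟨b, rfl⟩ := hs b
  obtain ⟨c, rfl⟩ := hs c
  simp only [← hf, ← map_add, IsLeibniz.leibniz a b c]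

theorem IsLeibniz.mul_self_mul [IsLeibniz L] (a b : L) : (a * a) * b = 0 := by
  rw [IsLeibniz.mul_mul_eq, sub_self]

theorem mul_self_mem_leib (a : L) : a * a ∈ leib F L := Submodule.subset_span ⟨a, rfl⟩

theorem mul_add_mul_mem_leib (a b : L) : a * b + b * a ∈ leib F L := by
  have : a * b + b * a = (a + b) * (a + b) - a * a - b * b := by
    simp only [mul_add, add_mul]; abel
  rw [this]
  exact sub_mem (sub_mem (mul_self_mem_leib _) (mul_self_mem_leib _)) (mul_self_mem_leib _)

variable [IsScalarTower F L L] [SMulCommClass F L L]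

theorem mul_eq_zero_of_mem_leib [IsLeibniz L] {s : L} (hs : s ∈ leib F L) (l : L) : s * l = 0 := by
  induction hs using Submodule.span_induction with
  | mem x h => obtain ⟨a, rfl⟩ := h; exact IsLeibniz.mul_self_mul a l
  | zero => exact zero_mul l
  | add x y _ _ hx hy => rw [add_mul, hx, hy, add_zero]
  | smul t x _ hx => rw [smul_mul_assoc, hx, smul_zero]

theorem isIdeal_leib [IsLeibniz L] : IsIdeal (leib F L) := by
  intro s hs l
  refine ⟨by rw [mul_eq_zero_of_mem_leib hs]; exact zero_mem _, ?_⟩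
  induction hs using Submodule.span_induction with
  | mem x h =>
    obtain ⟨a, rfl⟩ := h
    rw [IsLeibniz.leibniz]
    rw [add_comm]
    exact mul_add_mul_mem_leib _ _
  | zero => rw [mul_zero]; exact zero_mem _
  | add x y _ _ hx hy => rw [mul_add]; exact add_mem hx hy
  | smul t x _ hx => rw [mul_smul_comm]; exact Submodule.smul_mem _ _ hx

theorem isIdeal_mulSpan [IsLeibniz L] {A : Submodule F L} (hA : IsIdeal A) :
    IsIdeal (mulSpan F A A) := by
  intro w hw l
  induction hw using Submodule.span_induction with
  | mem x h =>
    obtain ⟨a, ha, b, hb, rfl⟩ := h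
    constructor
    · rw [IsLeibniz.mul_mul_eq]
      exact sub_mem (mul_mem_mulSpan ha (hA b hb l).1) (mul_mem_mulSpan hb (hA a ha l).1)
    · rw [IsLeibniz.leibniz]
      exact add_mem (mul_mem_mulSpan (hA a ha l).2 hb) (mul_mem_mulSpan ha (hA b hb l).2)
  | zero => simp
  | add x y _ _ hx hy =>
    rw [mul_add, add_mul]; exact ⟨add_mem hx.1 hy.1, add_mem hx.2 hy.2⟩
  | smul t x _ hx =>
    rw [mul_smul_comm, smul_mul_assoc]
    exact ⟨Submodule.smul_mem _ _ hx.1, Submodule.smul_mem _ _ hx.2⟩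

theorem IsMinimalIdeal.isIdeal {F L : Type*} [Field F] [NonUnitalNonAssocRing L] [Module F L]
    {A : Submodule F L} (hA : IsMinimalIdeal A) : IsIdeal A := hA.1

/-- `A²` is an ideal inside `A`; if it were all of `A`, then `A` would lie in every term of the
derived series. -/
theorem IsMinimalIdeal.mul_eq_zero [IsLeibniz L] (hsolv : IsSolvable F L) {A : Submodule F L}
    (hA : IsMinimalIdeal A) {a b : L} (ha : a ∈ A) (hb : b ∈ A) : a * b = 0 := by
  rcases hA.2.2 _ (isIdeal_mulSpan hA.isIdeal) (mulSpan_le fun u _ v hv => (hA.isIdeal v hv u).2) with h | h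
  · rw [← Submodule.mem_bot F, ← h]
    exact mul_mem_mulSpan ha hb
  · exfalso
    obtain ⟨n, hn⟩ := hsolv
    have : ∀ n, A ≤ derivedSeries F L n := by
      intro n
      induction n with
      | zero => exact le_top
      | succ n ih => rw [← h]; exact mulSpan_mono ih ih
    exact hA.2.1 (le_bot_iff.mp (hn ▸ this n))

/-- The right action on a minimal ideal of a Leibniz algebra is trivial or the opposite of the
left action. -/
theorem IsMinimalIdeal.right_mul [IsLeibniz L] {A : Submodule F L} (hA : IsMinimalIdeal A) :
    (A ≤ leib F L ∧ ∀ a ∈ A, ∀ l : L, a * l = 0) ∨ ∀ a ∈ A, ∀ l : L, a * l = -(l * a) := by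
  rcases hA.2.2 _ (hA.isIdeal.inf isIdeal_leib) inf_le_left with h | h
  · right
    intro a ha l
    rw [eq_neg_iff_add_eq_zero, ← Submodule.mem_bot F, ← h]
    exact ⟨add_mem (hA.isIdeal a ha l).1 (hA.isIdeal a ha l).2, mul_add_mul_mem_leib a l⟩
  · left
    have hle : A ≤ leib F L := inf_eq_left.mp h
    exact ⟨hle, fun a ha l => mul_eq_zero_of_mem_leib (hle ha) l⟩

/-- Left invariance suffices, because right multiplication on `A` is zero or minus left
multiplication. Thus `A` is irreducible for the left action. -/
theorem IsMinimalIdeal.eq_bot_or_eq [IsLeibniz L] {A : Submodule F L} (hA : IsMinimalIdeal A)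
    {W : Submodule F L} (hWA : W ≤ A) (hW : ∀ l, ∀ w ∈ W, l * w ∈ W) : W = ⊥ ∨ W = A := by
  refine hA.2.2 W (fun w hw l => ⟨?_, hW l w hw⟩) hWA
  rcases hA.right_mul with h | h
  · rw [h.2 w (hWA hw)]; exact zero_mem _
  · rw [h w (hWA hw)]; exact neg_mem (hW l w hw)

/-- The left action of `L` on an ideal. -/
def leftAction (A : Submodule F L) (hA : IsIdeal A) : L →ₗ[F] Module.End F A where
  toFun l := (LinearMap.mulLeft F l).restrict fun a ha => (hA a ha l).2
  map_add' l m := by ext a; exact add_mul l m a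
  map_smul' t l := by ext a; exact smul_mul_assoc t l a

@[simp]
theorem coe_leftAction (A : Submodule F L) (hA : IsIdeal A) (l : L) (a : A) :
    (leftAction A hA l a : L) = l * a := rfl

theorem leftAction_mul [IsLeibniz L] (A : Submodule F L) (hA : IsIdeal A) (l m : L) :
    leftAction A hA (l * m) =
      leftAction A hA l * leftAction A hA m - leftAction A hA m * leftAction A hA l := by
  ext a
  exact IsLeibniz.mul_mul_eq l m a

theorem IsMinimalIdeal.eq_bot_or_eq_top [IsLeibniz L] {A : Submodule F L} (hA : IsMinimalIdeal A)
    {W : Submodule F A} (hW : ∀ l, ∀ w ∈ W, leftAction A hA.isIdeal l w ∈ W) : W = ⊥ ∨ W = ⊤ := by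
  rcases hA.eq_bot_or_eq (W := W.map A.subtype) (Submodule.map_subtype_le _ _) (by
    rintro l _ ⟨w, hw, rfl⟩
    exact ⟨_, hW l w hw, rfl⟩) with h | h
  · left
    exact Submodule.map_injective_of_injective A.subtype_injective (h.trans (Submodule.map_bot _).symm)
  · right
    apply Submodule.map_injective_of_injective A.subtype_injective
    rw [h, Submodule.map_subtype_top]

/-- Schur's lemma: an eigenspace of an operator commuting with the action is invariant. The given
eigenvector replaces algebraic closedness. -/
theorem IsMinimalIdeal.eq_smul_one_of_commute [IsLeibniz L] {A : Submodule F L}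
    (hA : IsMinimalIdeal A) {T : Module.End F A} (hT : ∀ l, Commute T (leftAction A hA.isIdeal l))
    {v : A} (hv : v ≠ 0) {α : F} (h : T v = α • v) : T = α • 1 := by
  rcases hA.eq_bot_or_eq_top (W := Module.End.eigenspace T α) (by
    intro l w hw
    rw [Module.End.mem_eigenspace_iff] at hw ⊢
    rw [← Module.End.mul_apply, (hT l).eq, Module.End.mul_apply, hw, map_smul]) with h' | h'
  · exact absurd ((Submodule.mem_bot F).mp (h' ▸ Module.End.mem_eigenspace_iff.mpr h)) hv
  · ext1 w
    have : w ∈ Module.End.eigenspace T α := h' ▸ trivial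
    exact Module.End.mem_eigenspace_iff.mp this

/-- If all elements of `L` act by scalars on a minimal ideal, its dimension is at most one. -/
theorem IsMinimalIdeal.finrank_le_one [IsLeibniz L] {A : Submodule F L}
    (hA : IsMinimalIdeal A) (h : ∀ l, ∃ t : F, leftAction A hA.isIdeal l = t • 1) :
    Module.finrank F A ≤ 1 := by
  obtain ⟨a, ha, ha0⟩ := Submodule.exists_mem_ne_zero_of_ne_bot hA.2.1
  rcases hA.eq_bot_or_eq_top (W := Submodule.span F {(⟨a, ha⟩ : A)}) (by
    intro l w hw
    obtain ⟨t, ht⟩ := h l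
    rw [ht]
    exact Submodule.smul_mem _ t hw) with h' | h'
  · rw [Submodule.span_singleton_eq_bot] at h'
    exact absurd (congrArg Subtype.val h') ha0
  · rw [← finrank_top F A, ← h']
    exact Submodule.finrank_span_singleton_le _

end Leibniz

/-! ### Consequences of supersolvability modulo an ideal. -/

section Over

variable {F : Type*} [Field F] {L : Type*} [NonUnitalNonAssocRing L] [Module F L]
  [IsScalarTower F L L] [SMulCommClass F L L]

/-- On a chain factor of dimension at most one, `a` and `b` act by scalars, so `ab` acts by their
commutator, which is zero. Each step of the chain costs one more power. -/
theorem SupersolvableOver.exists_pow_mulLeft_mem [IsLeibniz L] {B : Submodule F L}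
    (h : SupersolvableOver F L B) (a b : L) :
    ∃ n : ℕ, ∀ l, (LinearMap.mulLeft F (a * b) ^ n) l ∈ B := by
  induction h with
  | top => exact ⟨0, fun _ => trivial⟩
  | step B x hB hC ih =>
    obtain ⟨n, hn⟩ := ih
    refine ⟨n + 1, fun l => ?_⟩
    rw [pow_succ', Module.End.mul_apply, LinearMap.mulLeft_apply]
    have hx : x ∈ B ⊔ Submodule.span F {x} :=
      Submodule.mem_sup_right (Submodule.mem_span_singleton_self x)
    obtain ⟨α, hα⟩ := exists_smul_add_of_mem_sup_span (hC.isIdeal x hx a).2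
    obtain ⟨β, hβ⟩ := exists_smul_add_of_mem_sup_span (hC.isIdeal x hx b).2
    obtain ⟨t, ht⟩ := exists_smul_add_of_mem_sup_span (hn l)
    generalize (LinearMap.mulLeft F (a * b) ^ n) l = c at ht
    have hxB : (a * b) * x ∈ B := by
      have : (a * b) * x = a * (b * x - β • x) + β • (a * x - α • x) - b * (a * x - α • x)
          - α • (b * x - β • x) := by
        rw [IsLeibniz.mul_mul_eq]
        simp only [mul_sub, smul_sub, mul_smul_comm, smul_smul, mul_comm α β]
        abel
      rw [this]
      exact sub_mem (sub_mem (add_mem (hB _ hβ a).2 (B.smul_mem _ hα)) (hB _ hα b).2)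
        (B.smul_mem _ hβ)
    have : (a * b) * c = (a * b) * (c - t • x) + t • ((a * b) * x) := by
      rw [mul_sub, mul_smul_comm]; abel
    rw [this]
    exact add_mem (hB _ ht _).2 (B.smul_mem _ hxB)

/-- Triangularity of `a` on the chain. An eigenvector `w` modulo the next ideal `C` is either one
modulo `B`, or `aw - αw` lies in `W` and in `C` but not in `B`, and is an eigenvector modulo `B`
because `C / B` is at most a line. -/
theorem SupersolvableOver.exists_eigenvector {B : Submodule F L}
    (h : SupersolvableOver F L B) (a : L) {W : Submodule F L} (hW : ∀ w ∈ W, a * w ∈ W)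
    (hWB : ¬ W ≤ B) : ∃ w ∈ W, w ∉ B ∧ ∃ α : F, a * w - α • w ∈ B := by
  induction h with
  | top => exact absurd le_top hWB
  | step B x hB hC ih =>
    have hscal : ∀ c ∈ B ⊔ Submodule.span F {x}, ∃ α : F, a * c - α • c ∈ B := by
      intro c hc
      have hx : x ∈ B ⊔ Submodule.span F {x} :=
        Submodule.mem_sup_right (Submodule.mem_span_singleton_self x)
      obtain ⟨α, hα⟩ := exists_smul_add_of_mem_sup_span (hC.isIdeal x hx a).2
      obtain ⟨t, ht⟩ := exists_smul_add_of_mem_sup_span hc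
      refine ⟨α, ?_⟩
      have : a * c - α • c = a * (c - t • x) - α • (c - t • x) + t • (a * x - α • x) := by
        simp only [mul_sub, smul_sub, mul_smul_comm, smul_smul, mul_comm t α]
        abel
      rw [this]
      exact add_mem (sub_mem (hB _ ht _).2 (B.smul_mem _ ht)) (B.smul_mem _ hα)
    by_cases hWC : W ≤ B ⊔ Submodule.span F {x}
    · obtain ⟨w, hw, hwB⟩ := Set.not_subset.mp hWB
      exact ⟨w, hw, hwB, hscal w (hWC hw)⟩
    · obtain ⟨w, hw, hwC, α, hα⟩ := ih hWC
      by_cases hc : a * w - α • w ∈ B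
      · exact ⟨w, hw, fun h' => hwC (Submodule.mem_sup_left h'), α, hc⟩
      · exact ⟨_, sub_mem (hW w hw) (W.smul_mem _ hw), hc, hscal _ hα⟩

/-- The first ideal of the chain that meets `A` contains it, while its predecessor meets `A` in
zero; so `A` embeds in a chain factor. -/
theorem SupersolvableOver.finrank_le_one [Module.Finite F L] {B : Submodule F L}
    (h : SupersolvableOver F L B) {A : Submodule F L} (hA : IsMinimalIdeal A) (hAB : A ⊓ B = ⊥) :
    Module.finrank F A ≤ 1 := by
  induction h with
  | top => exact absurd (inf_top_eq A ▸ hAB) hA.2.1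
  | step B x hB hC ih =>
    by_cases hAC : A ⊓ (B ⊔ Submodule.span F {x}) = ⊥
    · exact ih hAC
    · have hle := hA.eq_of_inf_ne_bot hC.isIdeal hAC
      have h1 := Submodule.finrank_sup_add_finrank_inf_eq A B
      rw [hAB, finrank_bot] at h1
      have h2 := Submodule.finrank_mono (sup_le hle le_sup_left : A ⊔ B ≤ B ⊔ Submodule.span F {x})
      have h3 := Submodule.finrank_add_le_finrank_add_finrank B (Submodule.span F {x})
      have h4 := Submodule.finrank_span_singleton_le (F := F) x
      omega

/-- If `L / B` is supersolvable and `B` acts by scalars on `A` but `L` does not, then some ideal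
acting by scalars has a one-dimensional extension to an ideal not acting by scalars. -/
theorem SupersolvableOver.exists_not_scalar {B A : Submodule F L} (hA : IsIdeal A)
    (h : SupersolvableOver F L B) (hB : ∀ b ∈ B, ∃ t : F, leftAction A hA b = t • 1)
    (hL : ∃ l, ¬ ∃ t : F, leftAction A hA l = t • 1) :
    ∃ (C : Submodule F L) (x : L), (∀ c ∈ C, ∃ t : F, leftAction A hA c = t • 1) ∧
      IsIdeal (C ⊔ Submodule.span F {x}) ∧ ¬ ∃ t : F, leftAction A hA x = t • 1 := by
  induction h with
  | top =>
    obtain ⟨l, hl⟩ := hL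
    exact absurd (hB l trivial) hl
  | step B x hB' hC ih =>
    by_cases hx : ∃ t : F, leftAction A hA x = t • 1
    · refine ih fun c hc => ?_
      obtain ⟨s, hs⟩ := exists_smul_add_of_mem_sup_span hc
      obtain ⟨t, ht⟩ := hx
      obtain ⟨r, hr⟩ := hB _ hs
      refine ⟨r + s * t, ?_⟩
      rw [map_sub, map_smul, ht, sub_eq_iff_eq_add] at hr
      rw [hr, add_smul, smul_smul]
    · exact ⟨B, x, hB, hC.isIdeal, hx⟩

/-- In a Leibniz algebra that is supersolvable modulo a minimal ideal `A` of dimension greater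
than one on which all elements have eigenvectors, some product `yx` acts on `A` as the identity,
or as `x`, which is then injective. -/
theorem IsMinimalIdeal.exists_mul_action [IsLeibniz L] [Module.Finite F L] {A : Submodule F L}
    (hA : IsMinimalIdeal A) (hAA : ∀ a ∈ A, ∀ b ∈ A, a * b = 0) (hover : SupersolvableOver F L A)
    (hdim : 1 < Module.finrank F A)
    (hev : ∀ l : L, ∃ v : A, v ≠ 0 ∧ ∃ α : F, leftAction A hA.isIdeal l v = α • v) :
    ∃ x y : L, leftAction A hA.isIdeal (y * x) = 1 ∨
      (Function.Injective (leftAction A hA.isIdeal x) ∧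
        leftAction A hA.isIdeal (y * x) = leftAction A hA.isIdeal x) := by
  obtain ⟨C, x, hC, hCx, hx⟩ := hover.exists_not_scalar hA.1
    (fun b hb => ⟨0, by ext a; simpa using hAA b hb a a.2⟩) (by
      by_contra! h
      exact absurd (hA.finrank_le_one h) (by omega))
  -- Modulo operators that are scalar on `A`, each left multiplication sends `x` to a multiple of
  -- itself.
  have key : ∀ l, ∃ t μ : F, ∃ c ∈ C, l * x = t • x + c ∧ leftAction A hA.isIdeal c = μ • 1 := by
    intro l
    obtain ⟨t, ht⟩ := exists_smul_add_of_mem_sup_span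
      (hCx x (Submodule.mem_sup_right (Submodule.mem_span_singleton_self x)) l).2
    obtain ⟨μ, hμ⟩ := hC _ ht
    exact ⟨t, μ, _, ht, by abel, hμ⟩
  by_cases h1 : ∃ (l : L) (μ : F), μ ≠ 0 ∧ leftAction A hA.isIdeal (l * x) = μ • 1
  · obtain ⟨l, μ, hμ, h⟩ := h1
    exact ⟨x, μ⁻¹ • l, Or.inl (by rw [smul_mul_assoc, map_smul, h, smul_smul, inv_mul_cancel₀ hμ,
      one_smul])⟩
  push Not at h1
  -- If every `lx` acts as zero, `x` commutes with the action and has an eigenvector, so it is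
  -- scalar, contrary to its choice.
  by_cases h2 : ∀ l, leftAction A hA.isIdeal (l * x) = 0
  · exfalso
    obtain ⟨v, hv, α, hα⟩ := hev x
    refine hx ⟨α, hA.eq_smul_one_of_commute (fun l => ?_) hv hα⟩
    have := h2 l
    rw [leftAction_mul, sub_eq_zero] at this
    exact this.symm
  push Not at h2
  obtain ⟨l, hl⟩ := h2
  obtain ⟨t, μ, c, hc, hlx, hcμ⟩ := key l
  have hρ : leftAction A hA.isIdeal (l * x) = t • leftAction A hA.isIdeal x + μ • 1 := by
    rw [hlx, map_add, map_smul, hcμ]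
  have ht : t ≠ 0 := by
    rintro rfl
    rw [zero_smul, zero_add] at hρ
    refine h1 l μ ?_ hρ
    rintro rfl
    exact hl (by rw [hρ, zero_smul])
  -- The correction of `x` by `t⁻¹c` absorbs the scalar part of `lx`, making `lx` act as a multiple
  -- of the corrected element.
  have hx' : leftAction A hA.isIdeal (x + t⁻¹ • c) = t⁻¹ • leftAction A hA.isIdeal (l * x) := by
    rw [hρ, map_add, map_smul, hcμ, smul_add, smul_smul t⁻¹ t, inv_mul_cancel₀ ht, one_smul]
  -- Subtracting a multiple of `l` from `m` cancels the `x` part, leaving a scalar; a nonzero one is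
  -- excluded by `h1`. Hence the kernel of the corrected `x` is invariant, and so zero.
  have hbr : ∀ m, ∃ s : F,
      leftAction A hA.isIdeal (m * (x + t⁻¹ • c)) = s • leftAction A hA.isIdeal (x + t⁻¹ • c) := by
    intro m
    obtain ⟨s, ν, d, hd, hmx, hdν⟩ := key m
    have e1 : leftAction A hA.isIdeal (m * (x + t⁻¹ • c)) = leftAction A hA.isIdeal (m * x) := by
      rw [mul_add, mul_smul_comm, map_add, map_smul, leftAction_mul _ _ m c, hcμ]
      simp
    have e2 : leftAction A hA.isIdeal ((m - (s * t⁻¹) • l) * x) = (ν - s * t⁻¹ * μ) • 1 := by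
      rw [sub_mul, smul_mul_assoc, map_sub, map_smul, hρ, hmx, map_add, map_smul, hdν, smul_add,
        smul_smul, smul_smul, mul_assoc s, inv_mul_cancel₀ ht, mul_one]
      module
    have e3 : ν - s * t⁻¹ * μ = 0 := by
      by_contra h
      exact h1 _ _ h e2
    refine ⟨s, ?_⟩
    rw [e1, hx', hρ, hmx, map_add, map_smul, hdν, smul_smul, smul_add, smul_smul, smul_smul,
      mul_assoc s, inv_mul_cancel₀ ht, mul_one, sub_eq_zero.mp e3]
  refine ⟨x + t⁻¹ • c, t⁻¹ • l, Or.inr ⟨?_, ?_⟩⟩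
  · rw [← LinearMap.ker_eq_bot]
    refine (hA.eq_bot_or_eq_top fun m w hw => ?_).resolve_right fun h => ?_
    · rw [LinearMap.mem_ker] at hw ⊢
      obtain ⟨s, hs⟩ := hbr m
      rw [leftAction_mul, sub_eq_iff_eq_add, eq_comm, ← eq_sub_iff_add_eq'] at hs
      rw [← Module.End.mul_apply, hs, LinearMap.sub_apply, Module.End.mul_apply,
        LinearMap.smul_apply, hw, map_zero, smul_zero, sub_zero]
    · rw [LinearMap.ker_eq_top, hx'] at h
      exact hl ((smul_eq_zero.mp h).resolve_left (inv_ne_zero ht))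
  · rw [hx', smul_mul_assoc, map_smul, mul_add, mul_smul_comm, map_add, map_smul,
      leftAction_mul _ _ l c, hcμ]
    simp

end Over

/-! ### Supersolvable subalgebras and the perturbation of two generators. -/

section Subalgebras

variable {F : Type*} [Field F] {L : Type*} [NonUnitalNonAssocRing L] [Module F L]
  [IsScalarTower F L L] [SMulCommClass F L L]

/-- The inclusion of a subalgebra, as a linear map. -/
def subalgebraIncl (S : NonUnitalSubalgebra F L) : S →ₗ[F] L := S.toSubmodule.subtype

theorem subalgebraIncl_mul (S : NonUnitalSubalgebra F L) (a b : S) :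
    subalgebraIncl S (a * b) = subalgebraIncl S a * subalgebraIncl S b := rfl

theorem subalgebraIncl_injective (S : NonUnitalSubalgebra F L) :
    Function.Injective (subalgebraIncl S) := Subtype.val_injective

instance (S : NonUnitalSubalgebra F L) [IsLeibniz L] : IsLeibniz S :=
  .of_injective (subalgebraIncl S) (subalgebraIncl_mul S) (subalgebraIncl_injective S)

instance (S : NonUnitalSubalgebra F L) [Module.Finite F L] : Module.Finite F S :=
  Module.Finite.of_injective (subalgebraIncl S) (subalgebraIncl_injective S)

theorem map_mulLeft_pow {L' : Type*} [NonUnitalNonAssocRing L'] [Module F L'] [SMulCommClass F L' L']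
    (f : L →ₗ[F] L') (hf : ∀ a b, f (a * b) = f a * f b) (a s : L) (n : ℕ) :
    f ((LinearMap.mulLeft F a ^ n) s) = (LinearMap.mulLeft F (f a) ^ n) (f s) := by
  induction n with
  | zero => rfl
  | succ n ih => simp [pow_succ', hf, ih]

/-- Products of elements of a supersolvable subalgebra act nilpotently on it. -/
theorem exists_pow_mulLeft_eq_zero [IsLeibniz L] [Module.Finite F L] {S : NonUnitalSubalgebra F L}
    (hS : IsSupersolvable F S) {a b s : L} (ha : a ∈ S) (hb : b ∈ S) (hs : s ∈ S) :
    ∃ n : ℕ, (LinearMap.mulLeft F (a * b) ^ n) s = 0 := by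
  obtain ⟨n, hn⟩ := hS.supersolvableOver_bot.exists_pow_mulLeft_mem ⟨a, ha⟩ ⟨b, hb⟩
  refine ⟨n, ?_⟩
  have := map_mulLeft_pow (subalgebraIncl S) (subalgebraIncl_mul S)
    ((⟨a, ha⟩ : S) * ⟨b, hb⟩) ⟨s, hs⟩ n
  rw [(Submodule.mem_bot F).mp (hn _), map_zero] at this
  exact this.symm

/-- Elements of a supersolvable subalgebra have eigenvectors in invariant subspaces. -/
theorem exists_eigenvector_of_isSupersolvable [Module.Finite F L] {S : NonUnitalSubalgebra F L}
    (hS : IsSupersolvable F S) {a : L} (ha : a ∈ S) {W : Submodule F L} (hWS : W ≤ S.toSubmodule)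
    (hW : ∀ w ∈ W, a * w ∈ W) (hW0 : W ≠ ⊥) : ∃ w ∈ W, w ≠ 0 ∧ ∃ α : F, a * w = α • w := by
  obtain ⟨w, hw, hw0, α, hα⟩ := hS.supersolvableOver_bot.exists_eigenvector ⟨a, ha⟩
    (W := W.comap (subalgebraIncl S)) (fun w hw => hW _ hw) (by
      obtain ⟨w, hw, hw0⟩ := Submodule.exists_mem_ne_zero_of_ne_bot hW0
      exact fun h => hw0 (congrArg Subtype.val ((Submodule.mem_bot F).mp
        (h (show (⟨w, hWS hw⟩ : S) ∈ W.comap (subalgebraIncl S) from hw)))))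
  refine ⟨w, hw, fun h => hw0 (by rw [Submodule.mem_bot]; exact Subtype.ext h), α, ?_⟩
  rw [Submodule.mem_bot, sub_eq_zero] at hα
  exact congrArg Subtype.val hα

theorem mulLeft_pow_eq_zero_imp {A : Submodule F L} (hA : IsIdeal A) {z : L}
    (hz : ∀ v ∈ A, z * v = 0 → v = 0) (n : ℕ) :
    ∀ v ∈ A, (LinearMap.mulLeft F z ^ n) v = 0 → v = 0 := by
  induction n with
  | zero => intro v _ h; exact h
  | succ n ih =>
    intro v hv h
    rw [pow_succ, Module.End.mul_apply] at h
    exact hz v hv (ih _ (hA v hv z).2 h)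

/-- If a product acts injectively on a nonzero abelian ideal, some two-generated subalgebra is not
supersolvable. -/
theorem exists_not_isSupersolvable_adjoin [IsLeibniz L] [Module.Finite F L] {A : Submodule F L}
    (hA : IsIdeal A) (hA0 : A ≠ ⊥) (hAA : ∀ a ∈ A, ∀ b ∈ A, a * b = 0) {a b : L}
    (hab : ∀ v ∈ A, (a * b) * v = 0 → v = 0) :
    ∃ a' b' : L, ¬ IsSupersolvable F (NonUnitalAlgebra.adjoin F {a', b'}) := by
  by_contra! hall
  have hnil : ∀ a' b', a' * b' = a * b → ∃ n, (LinearMap.mulLeft F (a * b) ^ n) a' = 0 ∧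
      (LinearMap.mulLeft F (a * b) ^ n) b' = 0 := by
    intro a' b' h
    have ha' : a' ∈ NonUnitalAlgebra.adjoin F {a', b'} :=
      NonUnitalAlgebra.subset_adjoin F (by simp)
    have hb' : b' ∈ NonUnitalAlgebra.adjoin F {a', b'} :=
      NonUnitalAlgebra.subset_adjoin F (by simp)
    obtain ⟨n, hn⟩ := exists_pow_mulLeft_eq_zero (hall a' b') ha' hb' ha'
    obtain ⟨m, hm⟩ := exists_pow_mulLeft_eq_zero (hall a' b') ha' hb' hb'
    rw [h] at hn hm
    refine ⟨m + n, ?_, ?_⟩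
    · rw [pow_add, Module.End.mul_apply, hn, map_zero]
    · rw [add_comm, pow_add, Module.End.mul_apply, hm, map_zero]
  -- Since `A² = 0`, this is exactly the change of `ab` when `a` becomes `a + w` and `b` becomes `b
  -- + v`.
  let φ : A × A →ₗ[F] A :=
    (leftAction A hA a).coprod
      ((LinearMap.mulRight F b).restrict fun v hv => (hA v hv b).1)
  obtain ⟨⟨v, w⟩, hvw, hne⟩ : ∃ p ∈ LinearMap.ker φ, p ≠ 0 := by
    apply Submodule.exists_mem_ne_zero_of_ne_bot
    apply LinearMap.ker_ne_bot_of_finrank_lt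
    rw [Module.finrank_prod]
    have := (Submodule.one_le_finrank_iff (R := F)).mpr hA0
    omega
  have hφ : a * (v : L) + (w : L) * b = 0 := congrArg Subtype.val (LinearMap.mem_ker.mp hvw)
  obtain ⟨n, hna, hnb⟩ := hnil a b rfl
  obtain ⟨m, hma, hmb⟩ := hnil (a + w) (b + v) (by
    rw [mul_add, add_mul, add_mul, hAA w w.2 v v.2, add_zero, add_assoc, add_comm ((w : L) * b),
      hφ, add_zero])
  -- Enough powers of `ab` kill both `c` and `c + u`, hence `u`; but `ab` is injective on `A`.
  have key : ∀ (c : L) (u : A), (LinearMap.mulLeft F (a * b) ^ n) c = 0 →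
      (LinearMap.mulLeft F (a * b) ^ m) (c + u) = 0 → u = 0 := by
    intro c u h1 h2
    apply Subtype.ext
    apply mulLeft_pow_eq_zero_imp hA hab (n + m) _ u.2
    have : (u : L) = (c + u) - c := by abel
    rw [this, map_sub, pow_add, Module.End.mul_apply, h2, map_zero, ← pow_add,
      add_comm n m, pow_add, Module.End.mul_apply, h1, map_zero, sub_zero]
  exact hne (Prod.ext (key b v hnb hmb) (key a w hna hma))

theorem isSupersolvable_adjoin_of_map {L' : Type*} [NonUnitalNonAssocRing L'] [Module F L']
    [IsScalarTower F L' L'] [SMulCommClass F L' L'] [Module.Finite F L] [Module.Finite F L']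
    (f : L →ₗ[F] L') (hf : ∀ a b, f (a * b) = f a * f b) {a b : L}
    (h : IsSupersolvable F (NonUnitalAlgebra.adjoin F {a, b})) :
    IsSupersolvable F (NonUnitalAlgebra.adjoin F {f a, f b}) := by
  let g : L →ₙₐ[F] L' :=
    { toFun := f, map_smul' := f.map_smul, map_zero' := map_zero f, map_add' := map_add f,
      map_mul' := hf }
  have hg : NonUnitalSubalgebra.map g (NonUnitalAlgebra.adjoin F {a, b}) =
      NonUnitalAlgebra.adjoin F {f a, f b} := by
    rw [NonUnitalAlgHom.map_adjoin, Set.image_pair]; rfl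
  have hm : ∀ s ∈ NonUnitalAlgebra.adjoin F {a, b}, f s ∈ NonUnitalAlgebra.adjoin F {f a, f b} :=
    fun s hs => hg ▸ NonUnitalSubalgebra.mem_map.mpr ⟨s, hs, rfl⟩
  refine h.of_surjective ((f ∘ₗ subalgebraIncl _).codRestrict
    (NonUnitalAlgebra.adjoin F {f a, f b}).toSubmodule fun s => hm s s.2) ?_ ?_
  · intro s t
    exact Subtype.ext (hf s t)
  · rintro ⟨t, ht⟩
    rw [← hg] at ht
    obtain ⟨s, hs, rfl⟩ := NonUnitalSubalgebra.mem_map.mp ht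
    exact ⟨⟨s, hs⟩, rfl⟩

theorem isSupersolvable_adjoin_of_coe [Module.Finite F L] {S : NonUnitalSubalgebra F L} {a b : S}
    (h : IsSupersolvable F (NonUnitalAlgebra.adjoin F {(a : L), (b : L)})) :
    IsSupersolvable F (NonUnitalAlgebra.adjoin F {a, b}) := by
  have hg : NonUnitalSubalgebra.map (NonUnitalSubalgebraClass.subtype S)
      (NonUnitalAlgebra.adjoin F {a, b}) = NonUnitalAlgebra.adjoin F {(a : L), (b : L)} := by
    rw [NonUnitalAlgHom.map_adjoin, Set.image_pair]; rfl
  refine h.of_injective ((subalgebraIncl S ∘ₗ subalgebraIncl _).codRestrict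
    (NonUnitalAlgebra.adjoin F {(a : L), (b : L)}).toSubmodule fun s =>
      hg ▸ NonUnitalSubalgebra.mem_map.mpr ⟨s, s.2, rfl⟩) (fun _ _ => rfl) ?_
  intro s t hst
  have h' := congrArg Subtype.val hst
  exact Subtype.ext (Subtype.ext h')

end Subalgebras

/-! ### The two-generator criterion for supersolvability. -/

section Criterion

universe u

variable {F : Type*} [Field F]

theorem SupersolvableOver.bot_of_finrank_le_one {L : Type*} [NonUnitalNonAssocRing L] [Module F L]
    [Module.Finite F L] {A : Submodule F L} (hover : SupersolvableOver F L A)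
    (hdim : Module.finrank F A ≤ 1) : SupersolvableOver F L ⊥ := by
  obtain ⟨a, ha⟩ := (finrank_le_one_iff (K := F)).mp hdim
  refine .step _ (a : L) isIdeal_bot ?_
  convert hover
  rw [bot_sup_eq]
  refine le_antisymm ((Submodule.span_singleton_le_iff_mem _ _).mpr a.2) fun v hv => ?_
  obtain ⟨t, ht⟩ := ha ⟨v, hv⟩
  exact Submodule.mem_span_singleton.mpr ⟨t, congrArg Subtype.val ht⟩

/-- A solvable Leibniz algebra is supersolvable if all its two-generated subalgebras are. -/
theorem isSupersolvable_of_forall_adjoin (n : ℕ) : ∀ (L : Type u) [NonUnitalNonAssocRing L]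
    [Module F L] [IsScalarTower F L L] [SMulCommClass F L L] [Module.Finite F L] [IsLeibniz L],
    Module.finrank F L = n → IsSolvable F L →
    (∀ a b : L, IsSupersolvable F (NonUnitalAlgebra.adjoin F {a, b})) → IsSupersolvable F L := by
  induction n using Nat.strong_induction_on with
  | _ n ih =>
  intro L _ _ _ _ _ _ hn hsolv h2
  apply isSupersolvable_of_supersolvableOver_bot
  rcases subsingleton_or_nontrivial L with hL | hL
  · rw [Subsingleton.elim (⊥ : Submodule F L) ⊤]
    exact .top
  obtain ⟨A, hA, -⟩ := exists_isMinimalIdeal_le (isIdeal_top (F := F) (L := L)) top_ne_bot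
  have hAA : ∀ a ∈ A, ∀ b ∈ A, a * b = 0 := fun a ha b hb => hA.mul_eq_zero hsolv ha hb
  have hover : SupersolvableOver F L A := by
    obtain ⟨Q, _, _, _, _, f, hs, hk, hf⟩ := exists_quotient A hA.isIdeal
    have : Module.Finite F Q := Module.Finite.of_surjective f hs
    have := IsLeibniz.of_surjective f hf hs
    have hQ : Module.finrank F Q < n := by
      have h1 := f.finrank_range_add_finrank_ker
      rw [LinearMap.range_eq_top.mpr hs, finrank_top, hk, hn] at h1
      have := (Submodule.one_le_finrank_iff (R := F)).mpr hA.2.1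
      omega
    have := (ih _ hQ Q rfl (hsolv.of_surjective f hf hs) (fun a b => by
      obtain ⟨a, rfl⟩ := hs a
      obtain ⟨b, rfl⟩ := hs b
      exact isSupersolvable_adjoin_of_map f hf (h2 a b))).supersolvableOver_bot.comap f hf
    rwa [Submodule.comap_bot, hk] at this
  have hdim : Module.finrank F A ≤ 1 := by
    by_contra! hdim
    obtain ⟨x, y, hxy⟩ := hA.exists_mul_action hAA hover hdim (by
      intro l
      obtain ⟨v, hv, hv0⟩ := Submodule.exists_mem_ne_zero_of_ne_bot hA.2.1
      have hl : l ∈ NonUnitalAlgebra.adjoin F {l, v} :=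
        NonUnitalAlgebra.subset_adjoin F (by simp)
      obtain ⟨w, hw, hw0, α, hα⟩ := exists_eigenvector_of_isSupersolvable (h2 l v) hl
        (W := (NonUnitalAlgebra.adjoin F {l, v}).toSubmodule ⊓ A) inf_le_left
        (fun w hw => ⟨mul_mem (s := NonUnitalAlgebra.adjoin F {l, v}) hl hw.1, (hA.isIdeal w hw.2 l).2⟩)
        ((Submodule.ne_bot_iff _).mpr
          ⟨v, ⟨NonUnitalAlgebra.subset_adjoin F (by simp), hv⟩, hv0⟩)
      exact ⟨⟨w, hw.2⟩, fun h => hw0 (congrArg Subtype.val h), α, Subtype.ext hα⟩)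
    obtain ⟨a, b, hab⟩ := exists_not_isSupersolvable_adjoin hA.isIdeal hA.2.1 hAA
      (a := y) (b := x) (by
        intro v hv hz
        have hz' : leftAction A hA.isIdeal (y * x) ⟨v, hv⟩ = 0 := Subtype.ext hz
        rcases hxy with h | ⟨hi, h⟩
        · rw [h] at hz'
          exact congrArg Subtype.val hz'
        · rw [h] at hz'
          exact congrArg Subtype.val (hi (hz'.trans (map_zero _).symm)))
    exact hab (h2 a b)
  exact hover.bot_of_finrank_le_one hdim

end Criterion

section Operators

variable {F : Type*} [Field F]

theorem prod_sub_cast {p : ℕ} [Fact p.Prime] [CharP F p] (t : F) :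
    ∏ i : ZMod p, (t - (i.cast : F)) = t ^ p - t := by
  have hmonic : (Polynomial.X ^ p - Polynomial.X : Polynomial (ZMod p)).Monic := by
    apply Polynomial.monic_X_pow_sub
    rw [Polynomial.degree_X]
    exact_mod_cast (Fact.out : p.Prime).one_lt
  have hroots : (Polynomial.X ^ p - Polynomial.X : Polynomial (ZMod p)).roots =
      Finset.univ.val := by
    have := FiniteField.roots_X_pow_card_sub_X (ZMod p)
    rwa [ZMod.card] at this
  have h := Polynomial.prod_multiset_X_sub_C_of_monic_of_roots_card_eq hmonic (by
    rw [hroots, FiniteField.X_pow_card_sub_X_natDegree_eq _ (Fact.out : p.Prime).one_lt]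
    simp [ZMod.card])
  rw [hroots] at h
  have h' := congrArg (Polynomial.eval₂ (ZMod.castHom (dvd_refl p) F) t) h
  simpa [Polynomial.eval₂_finsetProd, ← Finset.prod_eq_multiset_prod] using h'

variable {V : Type*} [AddCommGroup V] [Module F V]

theorem mul_pow_succ_of_commutator {X Y c : Module.End F V} (h : Y * X - X * Y = c)
    (hc : Commute c X) (n : ℕ) :
    Y * X ^ (n + 1) = X ^ (n + 1) * Y + (n + 1) • (X ^ n * c) := by
  rw [sub_eq_iff_eq_add] at h
  induction n with
  | zero => simp [h, add_comm]
  | succ n ih =>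
    rw [pow_succ X (n + 1), ← mul_assoc, ih, add_mul, mul_assoc _ Y X, h, mul_add, ← mul_assoc,
      smul_mul_assoc, mul_assoc _ c X, hc.eq, ← mul_assoc _ X c, ← pow_succ, ← pow_succ,
      add_smul (n + 1) 1, one_smul]
    abel

theorem commute_pow_of_commutator {p : ℕ} [Fact p.Prime] [CharP F p] {X Y c : Module.End F V}
    (h : Y * X - X * Y = c) (hc : Commute c X) : Commute Y (X ^ p) := by
  obtain ⟨n, hn⟩ : ∃ n, p = n + 1 := ⟨p - 1, by have := (Fact.out : p.Prime).pos; omega⟩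
  have := mul_pow_succ_of_commutator h hc n
  rw [← hn, ← Nat.cast_smul_eq_nsmul F, CharP.cast_eq_zero, zero_smul, add_zero] at this
  exact this

/-- A nonzero space with endomorphisms satisfying `[Y, X] = 1`, or `[Y, X] = X` with `X`
injective, lives in prime characteristic. -/
theorem exists_prime_charP [Module.Finite F V] [Nontrivial V] {X Y : Module.End F V}
    (h : Y * X - X * Y = 1 ∨ (Function.Injective X ∧ Y * X - X * Y = X)) :
    ∃ p : ℕ, p.Prime ∧ CharP F p := by
  have hzero : ((Module.finrank F V : ℕ) : F) = 0 := by
    rw [← LinearMap.trace_one]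
    rcases h with h | ⟨hi, h⟩
    · rw [← h, map_sub, LinearMap.trace_mul_comm, sub_self]
    · let Z : Module.End F V := ((LinearEquiv.ofInjectiveEndo X hi).symm : V →ₗ[F] V)
      have hXZ : X * Z = 1 := LinearMap.ext fun v =>
        (LinearEquiv.ofInjectiveEndo X hi).apply_symm_apply v
      have hZX : Z * X = 1 := LinearMap.ext fun v =>
        (LinearEquiv.ofInjectiveEndo X hi).symm_apply_apply v
      have : (1 : Module.End F V) = Y - X * (Y * Z) := by
        rw [← hXZ]
        nth_rewrite 1 [← h]
        rw [sub_mul, mul_assoc, hXZ, mul_one, mul_assoc]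
      rw [this, map_sub, LinearMap.trace_mul_comm, mul_assoc, hZX, mul_one, sub_self]
  obtain ⟨p, hp⟩ := CharP.exists F
  refine ⟨p, (CharP.char_is_prime_or_zero F p).resolve_right ?_, hp⟩
  rintro rfl
  have := CharP.charP_to_charZero F
  exact Module.finrank_pos.ne' (Nat.cast_eq_zero.mp hzero)

theorem exists_basis_shift {p : ℕ} [Fact p.Prime] [CharP F p] {X Y : Module.End F V} {v : V} {α : F}
    (h : Y * X - X * Y = X) (hX : X ^ p = 1) (hv : v ≠ 0) (hYv : Y v = α • v)
    (hirr : ∀ W : Submodule F V, (∀ w ∈ W, X w ∈ W) → (∀ w ∈ W, Y w ∈ W) → W = ⊥ ∨ W = ⊤) :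
    ∃ e : Module.Basis (ZMod p) F V, (∀ i, X (e i) = e (i + 1)) ∧
      ∀ i, Y (e i) = (α + (i.cast : F)) • e i := by
  have hshift : ∀ i : ZMod p, X ((X ^ i.val) v) = (X ^ (i + 1).val) v := by
    intro i
    rw [← Module.End.mul_apply, ← pow_succ', ZMod.val_add, ZMod.val_one, ← pow_eq_pow_mod _ hX]
  have heig : ∀ i : ZMod p, Y ((X ^ i.val) v) = (α + (i.cast : F)) • (X ^ i.val) v := by
    intro i
    rw [← ZMod.natCast_val i]
    generalize i.val = n
    cases n with
    | zero => simp [hYv]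
    | succ n =>
      rw [← Module.End.mul_apply, mul_pow_succ_of_commutator h (Commute.refl X), ← pow_succ,
        LinearMap.add_apply, Module.End.mul_apply, hYv, map_smul,
        ← Nat.cast_smul_eq_nsmul F, LinearMap.smul_apply, ← add_smul]
  have hne : ∀ i : ZMod p, (X ^ i.val) v ≠ 0 := by
    intro i h0
    apply hv
    have : (X ^ p) v = (X ^ (p - i.val)) ((X ^ i.val) v) := by
      rw [← Module.End.mul_apply, ← pow_add, Nat.sub_add_cancel i.val_lt.le]
    rw [h0, map_zero, hX] at this
    exact this
  have hli : LinearIndependent F fun i : ZMod p => (X ^ i.val) v := by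
    refine Module.End.eigenvectors_linearIndependent' Y (fun i : ZMod p => α + (i.cast : F)) ?_ _
      fun i => ⟨Module.End.mem_eigenspace_iff.mpr (heig i), hne i⟩
    intro i j hij
    exact ZMod.castHom_injective F (add_left_cancel hij)
  have hspan : Submodule.span F (Set.range fun i : ZMod p => (X ^ i.val) v) = ⊤ := by
    refine (hirr _ ?_ ?_).resolve_left ?_
    · intro w hw
      induction hw using Submodule.span_induction with
      | mem w hw =>
        obtain ⟨i, rfl⟩ := hw
        exact Submodule.subset_span ⟨i + 1, (hshift i).symm⟩
      | zero => simp
      | add u w _ _ hu hw => rw [map_add]; exact add_mem hu hw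
      | smul t w _ hw => rw [map_smul]; exact Submodule.smul_mem _ _ hw
    · intro w hw
      induction hw using Submodule.span_induction with
      | mem w hw =>
        obtain ⟨i, rfl⟩ := hw
        dsimp only
        rw [heig]
        exact Submodule.smul_mem _ _ (Submodule.subset_span ⟨i, rfl⟩)
      | zero => simp
      | add u w _ _ hu hw => rw [map_add]; exact add_mem hu hw
      | smul t w _ hw => rw [map_smul]; exact Submodule.smul_mem _ _ hw
    · exact (Submodule.ne_bot_iff _).mpr ⟨_, Submodule.subset_span ⟨0, rfl⟩, hne 0⟩
  refine ⟨Module.Basis.mk hli hspan.ge, fun i => ?_, fun i => ?_⟩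
  · simp only [Module.Basis.mk_apply, hshift]
  · simp only [Module.Basis.mk_apply, heig]

theorem exists_basis_heisenberg {p : ℕ} [Fact p.Prime] [CharP F p] {X Y : Module.End F V} {v : V}
    (h : Y * X - X * Y = 1) (hX : X ^ p = 1) (hv : v ≠ 0) (hYv : Y v = 0)
    (hirr : ∀ W : Submodule F V, (∀ w ∈ W, X w ∈ W) → (∀ w ∈ W, Y w ∈ W) → W = ⊥ ∨ W = ⊤) :
    ∃ e : Module.Basis (ZMod p) F V, (∀ i, X (e i) = e (i + 1)) ∧
      ∀ i, Y (e i) = ((i.cast : F) + 1) • e (i - 1) := by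
  have hp := (Fact.out : p.Prime).pos
  have hXX : X ^ (p - 1) * X = 1 := by rw [← pow_succ, Nat.sub_add_cancel hp, hX]
  have hinj : Function.Injective X := by
    intro a b hab
    have := congrArg (X ^ (p - 1)) hab
    rwa [← Module.End.mul_apply, ← Module.End.mul_apply, hXX] at this
  obtain ⟨f, hf1, hf2⟩ := exists_basis_shift (p := p) (X := X) (Y := X * Y) (α := 0) (v := v)
    (by rw [mul_assoc, ← mul_sub, h, mul_one]) hX hv (by simp [hYv]) (by
      intro W hW1 hW2
      refine hirr W hW1 fun w hw => ?_
      have hpow : ∀ n, ∀ w ∈ W, (X ^ n) w ∈ W := by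
        intro n
        induction n with
        | zero => exact fun _ h => h
        | succ n ih =>
          intro w hw
          rw [pow_succ, Module.End.mul_apply]
          exact ih _ (hW1 w hw)
      have := hpow (p - 1) _ (hW2 w hw)
      rwa [← Module.End.mul_apply, ← mul_assoc, hXX, one_mul] at this)
  have hY : ∀ i, Y (f i) = (i.cast : F) • f (i - 1) := by
    intro i
    apply hinj
    have := hf2 i
    rw [zero_add, Module.End.mul_apply] at this
    rw [this, map_smul, hf1, sub_add_cancel]
  refine ⟨f.reindex (Equiv.subRight (1 : ZMod p)), fun i => ?_, fun i => ?_⟩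
  · simp [hf1]
  · simp [hY, ZMod.cast_add (dvd_refl p)]

theorem exists_pow_sub_of_eigenvector {p : ℕ} [Fact p.Prime] [CharP F p] {X Y : Module.End F V}
    {α s τ : F} (e : Module.Basis (ZMod p) F V) (hX : ∀ i, X (e i) = e (i + 1))
    (hY : ∀ i, Y (e i) = (α + (i.cast : F)) • e i) {w : V} (hw : w ≠ 0)
    (h : Y w + s • X w = τ • w) : ∃ t, s = t ^ p - t := by
  rcases eq_or_ne s 0 with rfl | hs
  · exact ⟨0, by simp [(Fact.out : p.Prime).ne_zero]⟩
  have hcX : ∀ i, e.coord i (X w) = e.coord (i - 1) w := by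
    intro i
    have : e.coord i ∘ₗ X = e.coord (i - 1) := e.ext fun j => by
      simp [hX, Finsupp.single_apply, eq_sub_iff_add_eq]
    exact LinearMap.congr_fun this w
  have hcY : ∀ i, e.coord i (Y w) = (α + (i.cast : F)) * e.coord i w := by
    intro i
    have : e.coord i ∘ₗ Y = (α + (i.cast : F)) • e.coord i := e.ext fun j => by
      by_cases hij : j = i
      · simp [hY, hij]
      · simp [hY, hij]
    exact LinearMap.congr_fun this w
  have hrec : ∀ i, s * e.coord (i - 1) w = (τ - α - (i.cast : F)) * e.coord i w := by
    intro i
    have := congrArg (e.coord i) h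
    rw [map_add, map_smul, map_smul, hcX, hcY, smul_eq_mul, smul_eq_mul] at this
    linear_combination this
  have hne : ∀ i, e.coord i w ≠ 0 := by
    intro i hi
    have hn : ∀ n : ℕ, e.coord (i - n) w = 0 := by
      intro n
      induction n with
      | zero => simpa using hi
      | succ n ih =>
        have := hrec (i - n)
        rw [ih, mul_zero] at this
        rw [Nat.cast_succ, ← sub_sub]
        exact (mul_eq_zero.mp this).resolve_left hs
    apply hw
    apply e.repr.map_eq_zero_iff.mp
    ext j
    have := hn (i - j).val
    rw [ZMod.natCast_zmod_val, sub_sub_cancel] at this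
    exact this
  have hprod : ∏ i : ZMod p, (s * e.coord (i - 1) w) =
      ∏ i : ZMod p, ((τ - α - (i.cast : F)) * e.coord i w) := Finset.prod_congr rfl fun i _ => hrec i
  have hperm : ∏ i : ZMod p, e.coord (i - 1) w = ∏ i : ZMod p, e.coord i w :=
    (Equiv.subRight (1 : ZMod p)).prod_comp fun i => e.coord i w
  rw [Finset.prod_mul_distrib, Finset.prod_mul_distrib, hperm, prod_sub_cast] at hprod
  have hs' : s ^ p = (τ - α) ^ p - (τ - α) := by
    have := mul_right_cancel₀ (Finset.prod_ne_zero_iff.mpr fun i _ => hne i) hprod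
    simpa [ZMod.card] using this
  refine ⟨τ - α - s, ?_⟩
  have : (τ - α - s) ^ p = (τ - α) ^ p - s ^ p := sub_pow_char _ _
  rw [this, hs']
  ring

theorem eq_sq_of_eigenvector [CharP F 2] {X Y : Module.End F V} {b τ : F}
    (e : Module.Basis (ZMod 2) F V) (hX : ∀ i, X (e i) = e (i + 1))
    (hY : ∀ i, Y (e i) = ((i.cast : F) + 1) • e (i - 1)) {w : V} (hw : w ≠ 0)
    (h : X w + (b - 1) • Y w = τ • w) : b = τ ^ 2 := by
  have h2 : (2 : F) = 0 := CharP.cast_eq_zero F 2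
  have hwe : w = e.repr w 0 • e 0 + e.repr w 1 • e 1 := by
    conv_lhs => rw [← e.sum_repr w]
    exact Fin.sum_univ_two _
  have c1 : ((1 : ZMod 2).cast : F) = 1 := ZMod.cast_one (dvd_refl 2)
  have z1 : (1 : ZMod 2) + 1 = 0 := rfl
  have z2 : (0 : ZMod 2) - 1 = 1 := rfl
  generalize e.repr w 0 = c at hwe
  generalize e.repr w 1 = d at hwe
  have hYe : Y (e 1) = 0 := by rw [hY, c1, one_add_one_eq_two, h2, zero_smul]
  have hYe' : Y (e 0) = e 1 := by rw [hY, z2, ZMod.cast_zero, zero_add, one_smul]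
  have hXe : X (e 1) = e 0 := by rw [hX, z1]
  have hXe' : X (e 0) = e 1 := by rw [hX, zero_add]
  have hlin := h
  rw [hwe] at hlin
  simp only [map_add, map_smul, hYe, hYe', hXe, hXe', smul_zero, add_zero] at hlin
  have e01 : (0 : ZMod 2) ≠ 1 := zero_ne_one
  have h0 := congrArg (e.coord 0) hlin
  have h1 := congrArg (e.coord 1) hlin
  simp [e01, e01.symm] at h0 h1
  have hc : c ≠ 0 := by
    rintro rfl
    rw [mul_zero] at h0
    exact hw (by rw [hwe, h0]; simp)
  apply mul_right_cancel₀ hc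
  linear_combination h1 + τ * h0

end Operators

section Structure

variable {F : Type*} [Field F] {L : Type*} [NonUnitalNonAssocRing L] [Module F L]
  [IsScalarTower F L L] [SMulCommClass F L L]

theorem mul_mem_span_of_forall {N : Submodule F L} {s t : Set L}
    (h : ∀ u ∈ s, ∀ v ∈ t, u * v ∈ N) {a b : L} (ha : a ∈ Submodule.span F s)
    (hb : b ∈ Submodule.span F t) : a * b ∈ N := by
  induction ha using Submodule.span_induction with
  | mem u hu =>
    induction hb using Submodule.span_induction with
    | mem v hv => exact h u hu v hv
    | zero => rw [mul_zero]; exact zero_mem _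
    | add x y _ _ hx hy => rw [mul_add]; exact add_mem hx hy
    | smul t x _ hx => rw [mul_smul_comm]; exact N.smul_mem _ hx
  | zero => rw [zero_mul]; exact zero_mem _
  | add x y _ _ hx hy => rw [add_mul]; exact add_mem hx hy
  | smul t x _ hx => rw [smul_mul_assoc]; exact N.smul_mem _ hx

/-- The sum of an ideal and a subspace closed under products. -/
def sumSubalgebra {A N : Submodule F L} (hA : IsIdeal A) (hN : ∀ u ∈ N, ∀ v ∈ N, u * v ∈ N) :
    NonUnitalSubalgebra F L :=
  (A ⊔ N).toNonUnitalSubalgebra (by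
    intro x y hx hy
    obtain ⟨a, ha, u, hu, rfl⟩ := Submodule.mem_sup.mp hx
    obtain ⟨b, hb, v, hv, rfl⟩ := Submodule.mem_sup.mp hy
    rw [add_mul, mul_add, mul_add]
    exact add_mem (Submodule.mem_sup_left (add_mem (hA a ha b).1 (hA a ha v).1))
      (add_mem (Submodule.mem_sup_left (hA b hb u).2) (Submodule.mem_sup_right (hN u hu v hv))))

theorem sumSubalgebra_eq_top_iff {A N : Submodule F L} (hA : IsIdeal A)
    (hN : ∀ u ∈ N, ∀ v ∈ N, u * v ∈ N) : sumSubalgebra hA hN = ⊤ ↔ A ⊔ N = ⊤ := by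
  constructor
  · intro h
    rw [eq_top_iff]
    intro x _
    have : x ∈ sumSubalgebra hA hN := h ▸ NonUnitalAlgebra.mem_top
    exact this
  · intro h
    rw [eq_top_iff]
    intro x _
    have : x ∈ A ⊔ N := h ▸ Submodule.mem_top
    exact this

/-- In a `φ`-free algebra abelian minimal ideals are complemented by subalgebras. -/
theorem IsMinimalIdeal.exists_complement {A : Submodule F L} (hA : IsMinimalIdeal A)
    (hAA : ∀ a ∈ A, ∀ b ∈ A, a * b = 0) (hphi : IsPhiFree F L) :
    ∃ M : NonUnitalSubalgebra F L, M ≠ ⊤ ∧ IsCompl A M.toSubmodule := by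
  have hAφ : ¬ A ≤ (frattiniSubalgebra F L).toSubmodule := by
    intro h
    apply hA.2.1
    rw [← le_bot_iff, ← (show frattiniIdeal F L = ⊥ from hphi)]
    exact le_sSup ⟨hA.isIdeal, h⟩
  obtain ⟨a, ha, haφ⟩ := Set.not_subset.mp hAφ
  obtain ⟨M, hM, haM⟩ : ∃ M : NonUnitalSubalgebra F L, IsCoatom M ∧ a ∉ M := by
    by_contra! h
    exact haφ (NonUnitalAlgebra.mem_sInf.mpr fun M hM => h M hM)
  have hMM : ∀ u ∈ M.toSubmodule, ∀ v ∈ M.toSubmodule, u * v ∈ M.toSubmodule :=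
    fun u hu v hv => mul_mem (s := M) hu hv
  have htop : A ⊔ M.toSubmodule = ⊤ := by
    rw [← sumSubalgebra_eq_top_iff hA.isIdeal hMM]
    refine hM.2 _ (lt_of_le_of_ne (fun m hm => ?_) fun h => haM ?_)
    · exact (le_sup_right : M.toSubmodule ≤ A ⊔ M.toSubmodule) hm
    · rw [h]
      exact Submodule.mem_sup_left ha
  refine ⟨M, hM.1, ?_, codisjoint_iff.mpr htop⟩
  rw [disjoint_iff]
  refine (hA.2.2 _ (fun c hc l => ?_) inf_le_left).resolve_right fun h =>
    haM (inf_eq_left.mp h ha)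
  obtain ⟨b, hb, m, hm, rfl⟩ := Submodule.mem_sup.mp (htop ▸ Submodule.mem_top : l ∈ _)
  rw [mul_add, add_mul, hAA c hc.1 b hb, hAA b hb c hc.1, zero_add, zero_add]
  exact ⟨⟨(hA.isIdeal c hc.1 m).1, hMM _ hc.2 _ hm⟩, ⟨(hA.isIdeal c hc.1 m).2, hMM _ hm _ hc.2⟩⟩

theorem supersolvableOver_of_sup_eq_top [Module.Finite F L] {A : Submodule F L} (hA : IsIdeal A)
    {M : NonUnitalSubalgebra F L} (hM : IsSupersolvable F M) (h : A ⊔ M.toSubmodule = ⊤) :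
    SupersolvableOver F L A := by
  obtain ⟨Q, _, _, _, _, f, hs, hk, hf⟩ := exists_quotient A hA
  have : Module.Finite F Q := Module.Finite.of_surjective f hs
  have := (hM.of_surjective (f ∘ₗ subalgebraIncl M) (fun a b => hf a b) (fun q => by
    obtain ⟨l, rfl⟩ := hs q
    obtain ⟨a, ha, m, hm, rfl⟩ := Submodule.mem_sup.mp (h ▸ Submodule.mem_top : l ∈ _)
    refine ⟨⟨m, hm⟩, ?_⟩
    rw [← hk, LinearMap.mem_ker] at ha
    rw [map_add, ha, zero_add]
    rfl)).supersolvableOver_bot.comap f hf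
  rwa [Submodule.comap_bot, hk] at this

theorem leftAction_eq_zero_of_mem {A : Submodule F L} (hA : IsIdeal A)
    (hAA : ∀ a ∈ A, ∀ b ∈ A, a * b = 0) {a : L} (ha : a ∈ A) : leftAction A hA a = 0 := by
  ext b
  exact hAA a ha b b.2

/-- A complement of a unique minimal ideal acts faithfully on it. -/
theorem IsUniqueMinimalIdeal.eq_zero_of_leftAction_eq_zero [IsLeibniz L] [Module.Finite F L]
    {A : Submodule F L} (hu : IsUniqueMinimalIdeal A) (hA : IsMinimalIdeal A)
    {M : NonUnitalSubalgebra F L} (hAM : IsCompl A M.toSubmodule) {m : L} (hm : m ∈ M)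
    (h0 : leftAction A hA.isIdeal m = 0) : m = 0 := by
  set K : Submodule F L := M.toSubmodule ⊓ LinearMap.ker (leftAction A hA.isIdeal) with hK
  have hKI : IsIdeal K := by
    intro k hk l
    obtain ⟨a, ha, m, hm, rfl⟩ := Submodule.mem_sup.mp
      (hAM.sup_eq_top ▸ Submodule.mem_top : l ∈ A ⊔ M.toSubmodule)
    have hk0 : leftAction A hA.isIdeal k = 0 := hk.2
    have hka : k * a = 0 := congrArg Subtype.val (LinearMap.congr_fun hk0 ⟨a, ha⟩)
    have hak : a * k = 0 := by
      rcases hA.right_mul with h | h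
      · exact h.2 a ha k
      · rw [h a ha k, hka, neg_zero]
    rw [mul_add, add_mul, hka, hak, zero_add, zero_add]
    refine ⟨⟨mul_mem (s := M) hk.1 hm, ?_⟩, ⟨mul_mem (s := M) hm hk.1, ?_⟩⟩
    · rw [SetLike.mem_coe, LinearMap.mem_ker, leftAction_mul, hk0, zero_mul, mul_zero, sub_zero]
    · rw [SetLike.mem_coe, LinearMap.mem_ker, leftAction_mul, hk0, zero_mul, mul_zero, sub_zero]
  have hK0 : K = ⊥ := by
    by_contra hne
    obtain ⟨B, hB, hBK⟩ := exists_isMinimalIdeal_le hKI hne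
    rw [hu.2 B hB] at hBK
    exact hA.2.1 (eq_bot_iff.mpr (hAM.inf_eq_bot ▸ le_inf le_rfl (hBK.trans inf_le_left)))
  rw [← Submodule.mem_bot F, ← hK0]
  exact ⟨hm, h0⟩

theorem forall_of_sup_span_eq_top {A P : Submodule F L} {s : Set L}
    (h : A ⊔ Submodule.span F s = ⊤) (hA : A ≤ P) (hs : s ⊆ P) (l : L) : l ∈ P :=
  (top_le_iff.mp (h ▸ sup_le hA (Submodule.span_le.mpr hs)) : P = ⊤) ▸ Submodule.mem_top

theorem commute_leftAction_of_sup_span_eq_top {A : Submodule F L} (hA : IsIdeal A)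
    (hAA : ∀ a ∈ A, ∀ b ∈ A, a * b = 0) {s : Set L} (h : A ⊔ Submodule.span F s = ⊤)
    {T : Module.End F A} (hT : ∀ u ∈ s, Commute T (leftAction A hA u)) (l : L) :
    Commute T (leftAction A hA l) := by
  have h' := forall_of_sup_span_eq_top (P := (LinearMap.ker
      (LinearMap.mulLeft F T - LinearMap.mulRight F T)).comap (leftAction A hA)) h
    (fun a ha => by simp [leftAction_eq_zero_of_mem hA hAA ha])
    (fun u hu => by simpa [sub_eq_zero] using (hT u hu).eq) l
  rw [commute_iff_eq]
  simpa [sub_eq_zero] using h'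

theorem IsMinimalIdeal.eq_bot_or_eq_top_of_span [IsLeibniz L] {A : Submodule F L}
    (hA : IsMinimalIdeal A) (hAA : ∀ a ∈ A, ∀ b ∈ A, a * b = 0) {s : Set L}
    (h : A ⊔ Submodule.span F s = ⊤) {W : Submodule F A}
    (hW : ∀ u ∈ s, ∀ w ∈ W, leftAction A hA.isIdeal u w ∈ W) : W = ⊥ ∨ W = ⊤ := by
  apply hA.eq_bot_or_eq_top
  let P : Submodule F L :=
    { carrier := {l | ∀ w ∈ W, leftAction A hA.isIdeal l w ∈ W}
      add_mem' := fun ha hb w hw => by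
        rw [map_add]; exact add_mem (ha w hw) (hb w hw)
      zero_mem' := fun w _ => by rw [map_zero]; exact zero_mem W
      smul_mem' := fun t a ha w hw => by
        rw [map_smul]; exact W.smul_mem t (ha w hw) }
  exact forall_of_sup_span_eq_top (P := P) h (fun a ha w _ => by
    rw [leftAction_eq_zero_of_mem hA.isIdeal hAA ha]; exact zero_mem W) hW

theorem lowerCentralSeries_le_of_injective {A : Submodule F L} [Module.Finite F L] (hA : IsIdeal A)
    {z : L} (hz : Function.Injective (leftAction A hA z)) {U : Submodule F L} (hzU : z ∈ U)
    (hAU : A ≤ U) (n : ℕ) : A ≤ lowerCentralSeries F U n := by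
  induction n with
  | zero => exact hAU
  | succ n ih =>
    intro a ha
    obtain ⟨b, hb⟩ := LinearMap.injective_iff_surjective.mp hz ⟨a, ha⟩
    have : z * b = a := congrArg Subtype.val hb
    rw [← this]
    exact mul_mem_mulSpan hzU (ih b.2)

theorem not_isStronglySolvable_of_injective {A : Submodule F L} [Module.Finite F L]
    (hA : IsIdeal A) (hA0 : A ≠ ⊥) {x y : L} (hz : Function.Injective (leftAction A hA (y * x))) :
    ¬ IsStronglySolvable F L := by
  rintro ⟨n, hn⟩
  apply hA0
  rw [← le_bot_iff, ← hn]
  refine lowerCentralSeries_le_of_injective hA hz (mul_mem_mulSpan (Submodule.mem_top (R := F)) Submodule.mem_top) (fun a ha => ?_) n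
  obtain ⟨b, hb⟩ := LinearMap.injective_iff_surjective.mp hz ⟨a, ha⟩
  rw [← (show y * x * b = a from congrArg Subtype.val hb)]
  exact mul_mem_mulSpan (Submodule.mem_top (R := F)) Submodule.mem_top

theorem isStronglySolvable_of_span_singleton {A : Submodule F L} (hA : IsIdeal A)
    (hAA : ∀ a ∈ A, ∀ b ∈ A, a * b = 0) {x : L} (hx : x * x = 0)
    (h : A ⊔ Submodule.span F {x} = ⊤) : IsStronglySolvable F L := by
  have hle : mulSpan F (⊤ : Submodule F L) ⊤ ≤ A := by
    apply mulSpan_le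
    intro u _ v _
    obtain ⟨a, ha, m, hm, rfl⟩ := Submodule.mem_sup.mp (h ▸ Submodule.mem_top : u ∈ _)
    obtain ⟨b, hb, k, hk, rfl⟩ := Submodule.mem_sup.mp (h ▸ Submodule.mem_top : v ∈ _)
    obtain ⟨s, rfl⟩ := Submodule.mem_span_singleton.mp hm
    obtain ⟨t, rfl⟩ := Submodule.mem_span_singleton.mp hk
    have : (s • x) * (t • x) = 0 := by
      rw [smul_mul_assoc, mul_smul_comm, hx, smul_zero, smul_zero]
    rw [mul_add, add_mul, add_mul, this, add_zero]
    exact add_mem (add_mem (hA a ha b).1 (hA b hb _).2) (hA a ha _).1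
  refine ⟨1, ?_⟩
  rw [← le_bot_iff]
  exact mulSpan_le fun u hu v hv => by rw [hAA u (hle hu) v (hle hv)]; exact zero_mem _

theorem isCompl_span_of_subset {A : Submodule F L} {M : NonUnitalSubalgebra F L}
    (hAM : IsCompl A M.toSubmodule) {s : Set L} (hs : s ⊆ M) (h : A ⊔ Submodule.span F s = ⊤) :
    IsCompl A (Submodule.span F s) :=
  ⟨hAM.disjoint.mono_right (Submodule.span_le.mpr hs), codisjoint_iff.mpr h⟩

theorem sup_span_eq_top_of_injective [IsLeibniz L] [Module.Finite F L] {A : Submodule F L}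
    (hA : IsIdeal A) (hA0 : A ≠ ⊥)
    (hmin : ∀ S : NonUnitalSubalgebra F L, S ≠ ⊤ → IsSupersolvable F S) {s : Set L}
    (hs : ∀ u ∈ s, ∀ v ∈ s, u * v ∈ Submodule.span F s) {x y : L} (hx : x ∈ s) (hy : y ∈ s)
    (hz : Function.Injective (leftAction A hA (y * x))) : A ⊔ Submodule.span F s = ⊤ := by
  have hN : ∀ u ∈ Submodule.span F s, ∀ v ∈ Submodule.span F s, u * v ∈ Submodule.span F s :=
    fun u hu v hv => mul_mem_span_of_forall hs hu hv
  rw [← sumSubalgebra_eq_top_iff hA hN]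
  by_contra hne
  obtain ⟨a, ha, ha0⟩ := Submodule.exists_mem_ne_zero_of_ne_bot hA0
  have hmem : ∀ u ∈ s, u ∈ sumSubalgebra hA hN := fun u hu =>
    Submodule.mem_sup_right (Submodule.subset_span hu)
  obtain ⟨n, hn⟩ := exists_pow_mulLeft_eq_zero (hmin _ hne) (hmem y hy) (hmem x hx)
    (show a ∈ sumSubalgebra hA hN from Submodule.mem_sup_left ha)
  refine ha0 (mulLeft_pow_eq_zero_imp hA (fun v hv h => ?_) n a ha hn)
  have := hz (a₁ := ⟨v, hv⟩) (a₂ := 0) (by rw [map_zero]; exact Subtype.ext h)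
  exact congrArg Subtype.val this

theorem exists_eigenvector_leftAction [Module.Finite F L] {A : Submodule F L}
    (hA : IsIdeal A) (hA0 : A ≠ ⊥)
    (hmin : ∀ S : NonUnitalSubalgebra F L, S ≠ ⊤ → IsSupersolvable F S) {x : L}
    (hxx : x * x = 0) (hx : A ⊔ Submodule.span F {x} ≠ ⊤) :
    ∃ v : A, v ≠ 0 ∧ ∃ α : F, leftAction A hA x v = α • v := by
  have hN : ∀ u ∈ Submodule.span F {x}, ∀ v ∈ Submodule.span F {x},
      u * v ∈ Submodule.span F {x} := fun u hu v hv => mul_mem_span_of_forall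
    (by rintro _ rfl _ rfl; rw [hxx]; exact zero_mem _) hu hv
  obtain ⟨w, hw, hw0, α, hα⟩ := exists_eigenvector_of_isSupersolvable
    (hmin _ (mt (sumSubalgebra_eq_top_iff hA hN).mp hx)) (a := x)
    (Submodule.mem_sup_right (Submodule.mem_span_singleton_self x)) (W := A)
    (fun a ha => Submodule.mem_sup_left ha) (fun w hw => (hA w hw x).2) hA0
  exact ⟨⟨w, hw⟩, fun h => hw0 (congrArg Subtype.val h), α, Subtype.ext hα⟩

end Structure

section Types

variable {F : Type*} [Field F] {L : Type*} [NonUnitalNonAssocRing L] [Module F L]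
  [IsScalarTower F L L] [SMulCommClass F L L]

theorem isNonabelianType_of_action [IsLeibniz L] [Module.Finite F L] {A : Submodule F L}
    (hA : IsMinimalIdeal A) (hAA : ∀ a ∈ A, ∀ b ∈ A, a * b = 0)
    (hmin : ∀ S : NonUnitalSubalgebra F L, S ≠ ⊤ → IsSupersolvable F S)
    {M : NonUnitalSubalgebra F L} (hAM : IsCompl A M.toSubmodule)
    (hinj : ∀ m ∈ M, ∀ n ∈ M, leftAction A hA.isIdeal m = leftAction A hA.isIdeal n → m = n)
    (hev : ∀ l : L, ∃ v : A, v ≠ 0 ∧ ∃ α : F, leftAction A hA.isIdeal l v = α • v)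
    {p : ℕ} (hp : p.Prime) [CharP F p] {x₀ y : L} (hx₀ : x₀ ∈ M) (hy : y ∈ M)
    (hx₀i : Function.Injective (leftAction A hA.isIdeal x₀))
    (hyx₀ : leftAction A hA.isIdeal (y * x₀) = leftAction A hA.isIdeal x₀) :
    IsNonabelianType p A := by
  have : Fact p.Prime := ⟨hp⟩
  obtain ⟨v, hv, d, hd⟩ := hev x₀
  have hd0 : d ≠ 0 := by
    rintro rfl
    rw [zero_smul] at hd
    exact hv (hx₀i (hd.trans (map_zero _).symm))
  obtain ⟨x, hx⟩ : ∃ x, x = d⁻¹ • x₀ := ⟨_, rfl⟩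
  have hxM : x ∈ M := hx ▸ SMulMemClass.smul_mem _ hx₀
  have hXv : leftAction A hA.isIdeal x v = v := by
    rw [hx, map_smul, LinearMap.smul_apply, hd, smul_smul, inv_mul_cancel₀ hd0, one_smul]
  have hXi : Function.Injective (leftAction A hA.isIdeal x) := by
    intro a b hab
    rw [hx, map_smul, LinearMap.smul_apply, LinearMap.smul_apply] at hab
    exact hx₀i (smul_right_injective _ (inv_ne_zero hd0) hab)
  have hyx : y * x = x := by
    apply hinj _ (mul_mem hy hxM) _ hxM
    rw [hx, mul_smul_comm, map_smul, map_smul, hyx₀]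
  have hbr := leftAction_mul A hA.isIdeal y x
  rw [hyx] at hbr
  have hsq : ∀ m ∈ M, m * m = 0 := fun m hm => hinj _ (mul_mem hm hm) _ (zero_mem M) (by
    rw [leftAction_mul, sub_self, map_zero])
  have hxy : x * y = -x := hinj _ (mul_mem hxM hy) _ (neg_mem hxM) (by
    rw [leftAction_mul, map_neg]; nth_rewrite 3 [hbr]; abel)
  have htop : A ⊔ Submodule.span F {x, y} = ⊤ := by
    have hxs : x ∈ Submodule.span F {x, y} := Submodule.subset_span (by simp)
    refine sup_span_eq_top_of_injective hA.isIdeal hA.2.1 hmin (x := x) (y := y) ?_ (by simp)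
      (by simp) (by rwa [hyx])
    rintro u (rfl | rfl) w (rfl | rfl)
    · rw [hsq _ hxM]; exact zero_mem _
    · rw [hxy]; exact neg_mem hxs
    · rw [hyx]; exact hxs
    · rw [hsq _ hy]; exact zero_mem _
  have hXp : leftAction A hA.isIdeal x ^ p = 1 := by
    have hXpv : ∀ n, (leftAction A hA.isIdeal x ^ n) v = v := by
      intro n
      induction n with
      | zero => rfl
      | succ n ih => rw [pow_succ, Module.End.mul_apply, hXv, ih]
    rw [hA.eq_smul_one_of_commute (T := leftAction A hA.isIdeal x ^ p) (α := 1) (fun l => ?_) hv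
      (by rw [hXpv, one_smul]), one_smul]
    refine commute_leftAction_of_sup_span_eq_top hA.isIdeal hAA htop ?_ l
    rintro u (rfl | rfl)
    · exact (Commute.refl _).pow_left p
    · exact (commute_pow_of_commutator hbr.symm (Commute.refl _)).symm
  obtain ⟨w, hw, α, hα⟩ := hev y
  obtain ⟨e, he1, he2⟩ := exists_basis_shift (p := p) hbr.symm hXp hw hα (by
    intro W hW1 hW2
    refine hA.eq_bot_or_eq_top_of_span hAA htop ?_
    rintro u (rfl | rfl)
    exacts [hW1, hW2])
  refine ⟨hAA, ⟨e, x, y, α, ?_, isCompl_span_of_subset hAM ?_ htop, fun i => ?_, fun i => ?_, hyx,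
    hxy, hsq _ hxM, hsq _ hy⟩, fun s => ?_⟩
  · have hx0 : x ≠ 0 := by
      rintro rfl
      exact hv (by rw [← hXv, map_zero, LinearMap.zero_apply])
    rw [LinearIndependent.pair_iff]
    intro s t hst
    have h1 : (s • x + t • y) * x = t • x := by
      rw [add_mul, smul_mul_assoc, smul_mul_assoc, hsq x hxM, hyx, smul_zero, zero_add]
    rw [hst, zero_mul] at h1
    have ht : t = 0 := (smul_eq_zero.mp h1.symm).resolve_right hx0
    rw [ht, zero_smul, add_zero] at hst
    exact ⟨(smul_eq_zero.mp hst).resolve_right hx0, ht⟩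
  · rintro u (rfl | rfl)
    exacts [hxM, hy]
  · exact congrArg Subtype.val (he1 i)
  · exact congrArg Subtype.val (he2 i)
  · obtain ⟨u, hu, τ, hτ⟩ := hev (y + s • x)
    exact exists_pow_sub_of_eigenvector e he1 he2 hu (by rw [← hτ]; simp)

theorem isHeisenbergType_of_action [IsLeibniz L] [Module.Finite F L] {A : Submodule F L}
    (hA : IsMinimalIdeal A) (hAA : ∀ a ∈ A, ∀ b ∈ A, a * b = 0)
    (hmin : ∀ S : NonUnitalSubalgebra F L, S ≠ ⊤ → IsSupersolvable F S)
    {M : NonUnitalSubalgebra F L} (hAM : IsCompl A M.toSubmodule)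
    (hinj : ∀ m ∈ M, ∀ n ∈ M, leftAction A hA.isIdeal m = leftAction A hA.isIdeal n → m = n)
    (hev : ∀ l : L, ∃ v : A, v ≠ 0 ∧ ∃ α : F, leftAction A hA.isIdeal l v = α • v)
    {p : ℕ} (hp : p.Prime) [CharP F p] {x₀ y₀ : L} (hx₀ : x₀ ∈ M) (hy₀ : y₀ ∈ M)
    (hyx₀ : leftAction A hA.isIdeal (y₀ * x₀) = 1) : IsHeisenbergType p A := by
  have : Fact p.Prime := ⟨hp⟩
  obtain ⟨z, hz⟩ : ∃ z, z = y₀ * x₀ := ⟨_, rfl⟩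
  rw [← hz] at hyx₀
  have hzM : z ∈ M := hz ▸ mul_mem hy₀ hx₀
  have hsq : ∀ m ∈ M, m * m = 0 := fun m hm => hinj _ (mul_mem hm hm) _ (zero_mem M) (by
    rw [leftAction_mul, sub_self, map_zero])
  have hmz : ∀ m ∈ M, m * z = 0 := fun m hm => hinj _ (mul_mem hm hzM) _ (zero_mem M) (by
    rw [leftAction_mul, hyx₀, mul_one, one_mul, sub_self, map_zero])
  have hzm : ∀ m ∈ M, z * m = 0 := fun m hm => hinj _ (mul_mem hzM hm) _ (zero_mem M) (by
    rw [leftAction_mul, hyx₀, mul_one, one_mul, sub_self, map_zero])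
  obtain ⟨v, hv, d, hd⟩ := hev x₀
  obtain ⟨w, hw, α, hα⟩ := hev y₀
  obtain ⟨x, hx⟩ : ∃ x, x = x₀ + (1 - d) • z := ⟨_, rfl⟩
  obtain ⟨y, hy⟩ : ∃ y, y = y₀ - α • z := ⟨_, rfl⟩
  have hxM : x ∈ M := hx ▸ add_mem hx₀ (SMulMemClass.smul_mem _ hzM)
  have hyM : y ∈ M := hy ▸ sub_mem hy₀ (SMulMemClass.smul_mem _ hzM)
  have hXv : leftAction A hA.isIdeal x v = v := by
    rw [hx, map_add, map_smul, LinearMap.add_apply, LinearMap.smul_apply, hd, hyx₀,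
      Module.End.one_apply, ← add_smul, add_sub_cancel, one_smul]
  have hYw : leftAction A hA.isIdeal y w = 0 := by
    rw [hy, map_sub, map_smul, LinearMap.sub_apply, LinearMap.smul_apply, hα, hyx₀,
      Module.End.one_apply, sub_self]
  have hyx : y * x = z := by
    rw [hx, mul_add, mul_smul_comm, hmz y hyM, smul_zero, add_zero, hy, sub_mul, smul_mul_assoc,
      hzm x₀ hx₀, smul_zero, sub_zero, hz]
  have hbr := leftAction_mul A hA.isIdeal y x
  rw [hyx, hyx₀] at hbr
  have hxy : x * y = -z := hinj _ (mul_mem hxM hyM) _ (neg_mem hzM) (by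
    rw [leftAction_mul, map_neg, hyx₀, hbr]; abel)
  have htop : A ⊔ Submodule.span F {x, y, z} = ⊤ := by
    have hzs : z ∈ Submodule.span F {x, y, z} := Submodule.subset_span (by simp)
    refine sup_span_eq_top_of_injective hA.isIdeal hA.2.1 hmin (x := x) (y := y) ?_ (by simp)
      (by simp) (by rw [hyx, hyx₀]; exact fun _ _ h => h)
    rintro u (rfl | rfl | rfl) w (rfl | rfl | rfl)
    · rw [hsq _ hxM]; exact zero_mem _
    · rw [hxy]; exact neg_mem hzs
    · rw [hmz _ hxM]; exact zero_mem _
    · rw [hyx]; exact hzs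
    · rw [hsq _ hyM]; exact zero_mem _
    · rw [hmz _ hyM]; exact zero_mem _
    · rw [hzm _ hxM]; exact zero_mem _
    · rw [hzm _ hyM]; exact zero_mem _
    · rw [hsq _ hzM]; exact zero_mem _
  have hXp : leftAction A hA.isIdeal x ^ p = 1 := by
    have hXpv : ∀ n, (leftAction A hA.isIdeal x ^ n) v = v := by
      intro n
      induction n with
      | zero => rfl
      | succ n ih => rw [pow_succ, Module.End.mul_apply, hXv, ih]
    rw [hA.eq_smul_one_of_commute (T := leftAction A hA.isIdeal x ^ p) (α := 1) (fun l => ?_) hv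
      (by rw [hXpv, one_smul]), one_smul]
    refine commute_leftAction_of_sup_span_eq_top hA.isIdeal hAA htop ?_ l
    rintro u (rfl | rfl | rfl)
    · exact (Commute.refl _).pow_left p
    · exact (commute_pow_of_commutator hbr.symm (Commute.one_left _)).symm
    · rw [hyx₀]; exact Commute.one_right _
  obtain ⟨e, he1, he2⟩ := exists_basis_heisenberg (p := p) hbr.symm hXp hw hYw (by
    intro W hW1 hW2
    refine hA.eq_bot_or_eq_top_of_span hAA htop ?_
    rintro u (rfl | rfl | rfl)
    · exact hW1
    · exact hW2
    · rw [hyx₀]; exact fun _ h => h)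
  refine ⟨hAA, ⟨e, x, y, z, ?_, isCompl_span_of_subset hAM ?_ htop, fun i => ?_, fun i => ?_,
    fun i => ?_, hyx, hxy, hmz _ hxM, hzm _ hxM, hmz _ hyM, hzm _ hyM, hsq _ hxM, hsq _ hyM,
    hsq _ hzM⟩, ?_⟩
  · have hz0 : z ≠ 0 := by
      rintro rfl
      rw [map_zero] at hyx₀
      exact hv (LinearMap.congr_fun hyx₀ v).symm
    rw [Fintype.linearIndependent_iff]
    intro g hg
    rw [Fin.sum_univ_three] at hg
    simp only [Matrix.cons_val_zero, Matrix.cons_val_one, Matrix.cons_val] at hg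
    have h1 : (g 0 • x + g 1 • y + g 2 • z) * x = g 1 • z := by
      rw [add_mul, add_mul, smul_mul_assoc, smul_mul_assoc, smul_mul_assoc, hsq x hxM, hyx,
        hzm x hxM, smul_zero, smul_zero, zero_add, add_zero]
    have h2 : y * (g 0 • x + g 1 • y + g 2 • z) = g 0 • z := by
      rw [mul_add, mul_add, mul_smul_comm, mul_smul_comm, mul_smul_comm, hsq y hyM, hyx,
        hmz y hyM, smul_zero, smul_zero, add_zero, add_zero]
    rw [hg, zero_mul] at h1
    rw [hg, mul_zero] at h2
    have g1 : g 1 = 0 := (smul_eq_zero.mp h1.symm).resolve_right hz0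
    have g0 : g 0 = 0 := (smul_eq_zero.mp h2.symm).resolve_right hz0
    rw [g0, g1, zero_smul, zero_smul, zero_add, zero_add] at hg
    have g2 : g 2 = 0 := (smul_eq_zero.mp hg).resolve_right hz0
    intro i
    fin_cases i
    exacts [g0, g1, g2]
  · rintro u (rfl | rfl | rfl)
    exacts [hxM, hyM, hzM]
  · exact congrArg Subtype.val (he1 i)
  · exact congrArg Subtype.val (he2 i)
  · have := LinearMap.congr_fun hyx₀ (e i)
    exact congrArg Subtype.val this
  · rintro rfl
    have : PerfectRing F 2 := PerfectRing.ofSurjective F 2 fun b => by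
      obtain ⟨u, hu, τ, hτ⟩ := hev (x + (b - 1) • y)
      exact ⟨τ, (eq_sq_of_eigenvector e he1 he2 hu (by rw [← hτ]; simp)).symm⟩
    exact PerfectRing.toPerfectField F 2

theorem hasListedStructure_of_minimal [IsLeibniz L] [Module.Finite F L]
    (hsolv : IsSolvable F L) (hphi : IsPhiFree F L) (hns : ¬ IsSupersolvable F L)
    (hmin : ∀ S : NonUnitalSubalgebra F L, S ≠ ⊤ → IsSupersolvable F S) :
    HasListedStructure F L := by
  have hsplit : ∀ B : Submodule F L, IsMinimalIdeal B → ∃ M : NonUnitalSubalgebra F L,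
      IsCompl B M.toSubmodule ∧ SupersolvableOver F L B := by
    intro B hB
    obtain ⟨M, hM, hBM⟩ := hB.exists_complement (fun a ha b hb => hB.mul_eq_zero hsolv ha hb) hphi
    exact ⟨M, hBM, supersolvableOver_of_sup_eq_top hB.isIdeal (hmin M hM) hBM.sup_eq_top⟩
  have hbot : (⊤ : Submodule F L) ≠ ⊥ := fun h =>
    hns (isSupersolvable_of_supersolvableOver_bot (h ▸ .top))
  obtain ⟨A, hA, -⟩ := exists_isMinimalIdeal_le (isIdeal_top (F := F) (L := L)) hbot
  have hAA : ∀ a ∈ A, ∀ b ∈ A, a * b = 0 := fun a ha b hb => hA.mul_eq_zero hsolv ha hb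
  obtain ⟨M, hAM, hover⟩ := hsplit A hA
  have hdim : 1 < Module.finrank F A := by
    by_contra! h
    exact hns (isSupersolvable_of_supersolvableOver_bot (hover.bot_of_finrank_le_one h))
  have hu : IsUniqueMinimalIdeal A := by
    refine ⟨hA, fun B hB => ?_⟩
    by_contra hne
    obtain ⟨_, _, hoverB⟩ := hsplit B hB
    have hAB : A ⊓ B = ⊥ := by
      by_contra h
      rcases hB.2.2 A hA.isIdeal (hA.eq_of_inf_ne_bot hB.isIdeal h) with h' | h'
      · exact hA.2.1 h'
      · exact hne h'.symm
    exact absurd (hoverB.finrank_le_one hA hAB) (by omega)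
  have hinj : ∀ m ∈ M, ∀ n ∈ M, leftAction A hA.isIdeal m = leftAction A hA.isIdeal n → m = n := by
    intro m hm n hn h
    rw [← sub_eq_zero]
    exact hu.eq_zero_of_leftAction_eq_zero hA hAM (sub_mem hm hn) (by
      rw [map_sub, h, sub_self])
  have hsq : ∀ m ∈ M, m * m = 0 := fun m hm => hinj _ (mul_mem hm hm) _ (zero_mem M) (by
    rw [leftAction_mul, sub_self, map_zero])
  have hproj : ∀ l : L, ∃ m ∈ M, leftAction A hA.isIdeal l = leftAction A hA.isIdeal m := by
    intro l
    obtain ⟨a, ha, m, hm, rfl⟩ := Submodule.mem_sup.mp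
      (hAM.sup_eq_top ▸ Submodule.mem_top : l ∈ A ⊔ M.toSubmodule)
    exact ⟨m, hm, by rw [map_add, leftAction_eq_zero_of_mem hA.isIdeal hAA ha, zero_add]⟩
  have hnonlie : ¬ IsLie L → A = leib F L ∧ ∀ a ∈ A, ∀ l : L, a * l = 0 := by
    intro hL
    have hleib : leib F L ≠ ⊥ := by
      intro h
      refine hL fun a => ?_
      rw [← Submodule.mem_bot F, ← h]
      exact mul_self_mem_leib a
    obtain ⟨B, hB, hBl⟩ := exists_isMinimalIdeal_le isIdeal_leib hleib
    rw [hu.2 B hB] at hBl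
    refine ⟨le_antisymm hBl fun s hs => ?_, fun a ha l => mul_eq_zero_of_mem_leib (hBl ha) l⟩
    obtain ⟨a, ha, m, hm, rfl⟩ := Submodule.mem_sup.mp
      (hAM.sup_eq_top ▸ Submodule.mem_top : s ∈ A ⊔ M.toSubmodule)
    have : m = 0 := hinj m hm 0 (zero_mem M) (by
      ext b
      have h0 := mul_eq_zero_of_mem_leib hs (b : L)
      rw [add_mul, hAA a ha b b.2, zero_add] at h0
      simpa using h0)
    rw [this, add_zero]
    exact ha
  by_cases hcyc : ∃ x ∈ M, A ⊔ Submodule.span F {x} = ⊤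
  · obtain ⟨x, hx, htop⟩ := hcyc
    refine ⟨A, hu, fun _ => ⟨hdim, hAA, x, ?_, hsq x hx,
      isCompl_span_of_subset hAM (by simpa using hx) htop⟩, fun h => absurd
        (isStronglySolvable_of_span_singleton hA.isIdeal hAA (hsq x hx) htop) h, hnonlie⟩
    rintro rfl
    rw [Submodule.span_zero_singleton, sup_bot_eq] at htop
    refine absurd (hA.finrank_le_one fun l => ⟨0, ?_⟩) (by omega)
    rw [leftAction_eq_zero_of_mem hA.isIdeal hAA (htop ▸ Submodule.mem_top), zero_smul]
  push Not at hcyc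
  have hev : ∀ l : L, ∃ v : A, v ≠ 0 ∧ ∃ α : F, leftAction A hA.isIdeal l v = α • v := by
    intro l
    obtain ⟨m, hm, h⟩ := hproj l
    rw [h]
    exact exists_eigenvector_leftAction hA.isIdeal hA.2.1 hmin (hsq m hm) (hcyc m hm)
  obtain ⟨x', y', hxy'⟩ := hA.exists_mul_action hAA hover hdim hev
  obtain ⟨x, hx, hxx'⟩ := hproj x'
  obtain ⟨y, hy, hyy'⟩ := hproj y'
  rw [leftAction_mul, hxx', hyy', ← leftAction_mul] at hxy'
  have : Nontrivial A := Module.nontrivial_of_finrank_pos (R := F) (by omega)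
  obtain ⟨p, hp, hcp⟩ := exists_prime_charP
    (X := leftAction A hA.isIdeal x) (Y := leftAction A hA.isIdeal y)
    (by rwa [← leftAction_mul])
  have hinjz : Function.Injective (leftAction A hA.isIdeal (y * x)) := by
    rcases hxy' with h | ⟨hi, h⟩
    · rw [h]; exact fun _ _ h => h
    · rwa [h]
  refine ⟨A, hu, fun h => absurd h
    (not_isStronglySolvable_of_injective hA.isIdeal hA.2.1 hinjz), fun _ => ⟨p, hp, hcp, ?_⟩, hnonlie⟩
  rcases hxy' with h | ⟨hi, h⟩
  · exact Or.inr (isHeisenbergType_of_action hA hAA hmin hAM hinj hev hp hx hy h)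
  · exact Or.inl (isNonabelianType_of_action hA hAA hmin hAM hinj hev hp hx hy hi h)

end Types

end LeibnizAlg

theorem mainTheorem10 {F : Type*} [Field F] {L : Type*} [NonUnitalNonAssocRing L] [Module F L]
    [IsScalarTower F L L] [SMulCommClass F L L] [Module.Finite F L]
    [LeibnizAlg.IsLeibniz L]
    (hsolv : LeibnizAlg.IsSolvable F L)
    (hphi : LeibnizAlg.IsPhiFree F L)
    (hns : ¬ LeibnizAlg.IsSupersolvable F L)
    (h2 : ∀ S : NonUnitalSubalgebra F L, LeibnizAlg.IsTwoGenerated S → S ≠ ⊤ →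
      LeibnizAlg.IsSupersolvable F S) :
    LeibnizAlg.IsMinimallyNonSupersolvable F L ∧ LeibnizAlg.HasListedStructure F L := by
  have hmin : ∀ S : NonUnitalSubalgebra F L, S ≠ ⊤ → LeibnizAlg.IsSupersolvable F S := by
    intro S hS
    refine LeibnizAlg.isSupersolvable_of_forall_adjoin _ S rfl
      (hsolv.of_injective (LeibnizAlg.subalgebraIncl S) (LeibnizAlg.subalgebraIncl_mul S)
        (LeibnizAlg.subalgebraIncl_injective S)) fun a b =>
      LeibnizAlg.isSupersolvable_adjoin_of_coe (h2 _ ⟨a, b, rfl⟩ fun h => hS ?_)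
    rw [eq_top_iff, ← h]
    refine NonUnitalAlgebra.adjoin_le ?_
    rintro _ (rfl | rfl)
    exacts [a.2, b.2]
  exact ⟨⟨hns, hmin⟩, LeibnizAlg.hasListedStructure_of_minimal hsolv hphi hns hmin⟩
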